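/- Let $n_1,n_2\ge 1$, and let $\mathbb R^{n_1}$ and $\mathbb R^{n_2}$ each carry the $\ell^\infty$ metric. For $x=(x_1,x_2)\in\mathbb R^{n_1}\times\mathbb R^{n_2}$ and $r>0$ put $$B(x,r)=\{y\in\mathbb R^{n_1}\times\mathbb R^{n_2}: |y_1-x_1|+|y_2-x_2|<r\}.$$ Write $\langle g\rangle_E=|E|^{-1}\int_E g\,dx$, and $\tau_y f(x)=f(x-y)$. A weight is a measurable function $w$ on $\mathbb R^{n_1}\times\mathbb R^{n_2}$ with $0<w<\infty$ a.e. For $1<p<\infty$ and $p'=p/(p-1)$, the bi-parameter class $A_p(\mathbb R^{n_1}\times\mathbb R^{n_2})$ consists of the weights $w$ with $$\sup_R \langle w\rangle_R\,\langle w^{1-p'}\rangle_R^{p-1}<\infty,$$ where $R$ runs over all products $Q_1\times Q_2$ of cubes $Q_i\subset\mathbb R^{n_i}$ of arbitrary side lengths. For $0<p<\infty$, $L^p(w)$ is the space of (classes of) real- or complex-valued measurable functions $f$ with $\|f\|_{L^p(w)}=(\int|f|^p w\,dx)^{1/p}<\infty$, with the topology of this (quasi-)norm. A subset of $L^p(w)$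 is precompact if its closure in $L^p(w)$ is compact. **(i)** Let $w\in A_{p_0}(\mathbb R^{n_1}\times\mathbb R^{n_2})$ for some $1<p_0<\infty$, let $0<p<\infty$, $0<a<\min\{p/p_0,1\}$ and $\mathcal K\subseteq L^p(w)$. Then $\mathcal K$ is precompact in $L^p(w)$ if and only if all of the following hold: (a) $\displaystyle\sup_{f\in\mathcal K}\|f\|_{L^p(w)}<\infty$; (b) $\displaystyle\lim_{A\to\infty}\sup_{f\in\mathcal K}\|f\mathbf 1_{B(0,A)^c}\|_{L^p(w)}=0$; (c) $\displaystyle\lim_{r\to0^+}\sup_{f\in\mathcal K}\Big\|\Big(\frac{1}{|B(0,r)|}\int_{B(0,r)}|\tau_yf-f|^a\,dy\Big)^{1/a}\Big\|_{L^p(w)}=0$. **(ii)** Let $1<p<\infty$, $w\in A_p(\mathbb R^{n_1}\times\mathbb R^{n_2})$ and $\mathcal K\subseteq L^p(w)$. Then $\mathcal K$ is precompact in $L^p(w)$ if and only if (a), (b) and the following hold: (c') $\displaystyle\lim_{r\to0^+}\sup_{f\in\mathcal K}\big\|f-\langle f\rangle_{B(\cdot,r)}\big\|_{L^p(w)}=0$.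 -/

import Mathlib

open MeasureTheory Set Filter Topology
open scoped ENNReal

namespace BiParam

/-- The product space `ℝ^{n₁} × ℝ^{n₂}`; each factor carries the `ℓ^∞` metric, and the measure
`volume` is Lebesgue measure on the product. -/
abbrev Space (n₁ n₂ : ℕ) : Type := (Fin n₁ → ℝ) × (Fin n₂ → ℝ)

/-- The cube `∏ᵢ [cᵢ, cᵢ + ℓ)` in `ℝⁿ`. -/
def cube {n : ℕ} (c : Fin n → ℝ) (ℓ : ℝ) : Set (Fin n → ℝ) :=
  Set.pi univ fun i => Ico (c i) (c i + ℓ)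

/-- The family of products `Q₁ × Q₂` of cubes `Q₁ ⊆ ℝ^{n₁}` and `Q₂ ⊆ ℝ^{n₂}`, whose side lengths
are positive and independent of each other. -/
def rectangles (n₁ n₂ : ℕ) : Set (Set (Space n₁ n₂)) :=
  {R | ∃ (c₁ : Fin n₁ → ℝ) (ℓ₁ : ℝ) (c₂ : Fin n₂ → ℝ) (ℓ₂ : ℝ),
    0 < ℓ₁ ∧ 0 < ℓ₂ ∧ R = cube c₁ ℓ₁ ×ˢ cube c₂ ℓ₂}

/-- A weight: a Lebesgue measurable function with `0 < w < ∞` almost everywhere. -/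
def IsWeight {n₁ n₂ : ℕ} (w : Space n₁ n₂ → ℝ≥0∞) : Prop :=
  AEMeasurable w volume ∧ ∀ᵐ x ∂(volume : Measure (Space n₁ n₂)), 0 < w x ∧ w x < ∞

/-- The bi-parameter `A_p` constant `sup_R ⟨w⟩_R ⟨w^{1-p'}⟩_R^{p-1}`, where `p' = p / (p - 1)`. -/
noncomputable def apConst {n₁ n₂ : ℕ} (p : ℝ) (w : Space n₁ n₂ → ℝ≥0∞) : ℝ≥0∞ :=
  ⨆ R ∈ rectangles n₁ n₂,
    (⨍⁻ x in R, w x ∂volume) * (⨍⁻ x in R, w x ^ (1 - p.conjExponent) ∂volume) ^ (p - 1)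

/-- The bi-parameter Muckenhoupt class `A_p`, for `1 < p < ∞`. -/
def IsAp {n₁ n₂ : ℕ} (p : ℝ) (w : Space n₁ n₂ → ℝ≥0∞) : Prop :=
  IsWeight w ∧ apConst p w < ∞

/-- The measure `w dx`. -/
noncomputable abbrev wMeasure {n₁ n₂ : ℕ} (w : Space n₁ n₂ → ℝ≥0∞) : Measure (Space n₁ n₂) :=
  (volume : Measure (Space n₁ n₂)).withDensity w

/-- The weighted space `L^p(w)`, `0 < p < ∞`, of classes of `𝕜`-valued functions. -/
abbrev WLp (𝕜 : Type*) [RCLike 𝕜] {n₁ n₂ : ℕ} (p : ℝ) (w : Space n₁ n₂ → ℝ≥0∞) : Type _ :=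
  Lp 𝕜 (ENNReal.ofReal p) (wMeasure w)

/-- The topology on `L^p(w)` given by the (quasi-)norm: a set is open when it contains, with each of
its points, a (quasi-)norm ball around it. (Mathlib gives `Lp` a topology only for `1 ≤ p`.) -/
@[reducible] def quasiNormTopology (𝕜 : Type*) [RCLike 𝕜] {n₁ n₂ : ℕ} (p : ℝ) (w : Space n₁ n₂ → ℝ≥0∞) :
    TopologicalSpace (WLp 𝕜 p w) where
  IsOpen U := ∀ f ∈ U, ∃ ε : ℝ, 0 < ε ∧ ∀ g : WLp 𝕜 p w, ‖g - f‖ < ε → g ∈ U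
  isOpen_univ := fun _ _ => ⟨1, one_pos, fun _ _ => mem_univ _⟩
  isOpen_inter := by
    intro U V hU hV f hf
    obtain ⟨ε, hε, h1⟩ := hU f hf.1
    obtain ⟨δ, hδ, h2⟩ := hV f hf.2
    exact ⟨min ε δ, lt_min hε hδ, fun g hg =>
      ⟨h1 g (hg.trans_le (min_le_left _ _)), h2 g (hg.trans_le (min_le_right _ _))⟩⟩
  isOpen_sUnion := by
    intro S hS f hf
    obtain ⟨U, hU, hfU⟩ := hf
    obtain ⟨ε, hε, h⟩ := hS U hU f hfU
    exact ⟨ε, hε, fun g hg => ⟨U, hU, h g hg⟩⟩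

/-- `K ⊆ L^p(w)` is precompact: its closure is compact. -/
def IsPrecompact {𝕜 : Type*} [RCLike 𝕜] {n₁ n₂ : ℕ} {p : ℝ} {w : Space n₁ n₂ → ℝ≥0∞}
    (K : Set (WLp 𝕜 p w)) : Prop :=
  letI : TopologicalSpace (WLp 𝕜 p w) := quasiNormTopology 𝕜 p w
  IsCompact (closure K)

/-- The ball `{y : |y₁ - x₁| + |y₂ - x₂| < r}`. -/
def ball {n₁ n₂ : ℕ} (x : Space n₁ n₂) (r : ℝ) : Set (Space n₁ n₂) :=
  {y | ‖y.1 - x.1‖ + ‖y.2 - x.2‖ < r}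

/-- The (quasi-)norm of `f` in `L^p(w)`, as a possibly infinite number. -/
noncomputable def wNorm {F : Type*} [ENorm F] {n₁ n₂ : ℕ} (p : ℝ) (w : Space n₁ n₂ → ℝ≥0∞)
    (f : Space n₁ n₂ → F) : ℝ≥0∞ :=
  eLpNorm f (ENNReal.ofReal p) (wMeasure w)

/-- `K` is bounded in `L^p(w)`. -/
def UniformlyBounded {𝕜 : Type*} [RCLike 𝕜] {n₁ n₂ : ℕ} {p : ℝ} {w : Space n₁ n₂ → ℝ≥0∞}
    (K : Set (WLp 𝕜 p w)) : Prop :=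
  (⨆ f ∈ K, wNorm p w (f : Space n₁ n₂ → 𝕜)) < ∞

/-- The tails of the members of `K` outside `B(0, A)` tend to zero uniformly as `A → ∞`. -/
def UniformlySmallTails {𝕜 : Type*} [RCLike 𝕜] {n₁ n₂ : ℕ} {p : ℝ} {w : Space n₁ n₂ → ℝ≥0∞}
    (K : Set (WLp 𝕜 p w)) : Prop :=
  Tendsto (fun A : ℝ => ⨆ f ∈ K, wNorm p w ((ball 0 A)ᶜ.indicator (f : Space n₁ n₂ → 𝕜)))
    atTop (𝓝 0)

/-- `x ↦ (⨍_{B(0,r)} |f(x - y) - f(x)|^a dy)^{1/a}`. -/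
noncomputable def translationMean {𝕜 : Type*} [RCLike 𝕜] {n₁ n₂ : ℕ} (a r : ℝ)
    (f : Space n₁ n₂ → 𝕜) (x : Space n₁ n₂) : ℝ≥0∞ :=
  (⨍⁻ y in ball (0 : Space n₁ n₂) r, ‖f (x - y) - f x‖ₑ ^ a ∂volume) ^ (1 / a)

end BiParam

/-! This is a Kolmogorov–Riesz argument in which no maximal function appears. It uses `A_p` only on
boxes whose sides all have the same length, that is, on sup-norm balls up to null sets.

Since `L^p(w)` is complete for the metric `‖f - g‖ ^ min p 1`, which induces the quasinorm topology,
precompactness is total boundedness.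

Necessity: finite nets reduce uniform statements to single functions, provided that the functionals
are stable under `L^p(w)` perturbation. For translation means, stability is the boundedness of
averages at one scale on `L^q(w)`, `q ≥ p₀`, uniformly in the scale: use `A_{p₀}` and Jensen on each
ball of radius `2r`, then integrate over the centres by Tonelli. Applied to `|f|^a` with `q = p /
a`, it explains the bound `a < p / p₀`. Density of compactly supported continuous functions gives
the limit for one function, and (c') follows from the case `a = 1`.

Sufficiency: it is enough to approximate all members of the family on a bounded region by step
functions on one grid, because their values on finitely many cells form a bounded set in a
finite-dimensional space. Under (c) the step values are values of `f` at well-chosen points. Under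
(c') they are averages of `f` at cell centres, which are equicontinuous by Hölder's inequality and
absolute continuity of the integral of the dual weight. -/

namespace BiParam

/-! ### The quasinorm topology: metrization, completeness, total boundedness -/

section Quasinorm

variable {𝕜 : Type*} [RCLike 𝕜] {n₁ n₂ : ℕ} {p : ℝ} {w : Space n₁ n₂ → ℝ≥0∞}

/-- A sequence whose increments have geometrically small `p`-th moments converges almost
everywhere. -/
theorem ae_exists_tendsto_of_lintegral_increment_le {α E : Type*} [MeasurableSpace α]
    {μ : Measure α} [NormedAddCommGroup E] [CompleteSpace E] (hp : 0 < p) {f : ℕ → α → E}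
    (hf : ∀ n, AEStronglyMeasurable (f n) μ)
    (h : ∀ n, ∫⁻ x, ‖f (n + 1) x - f n x‖ₑ ^ p ∂μ ≤ (4⁻¹ : ℝ≥0∞) ^ n) :
    ∀ᵐ x ∂μ, ∃ l, Tendsto (fun n => f n x) atTop (𝓝 l) := by
  have hm : ∀ n, AEMeasurable (fun x => (2 : ℝ≥0∞) ^ n * ‖f (n + 1) x - f n x‖ₑ ^ p) μ := fun n =>
    ((((hf (n + 1)).sub (hf n)).enorm).pow_const p).const_mul _
  -- The factor `2 ^ n` leaves the convergent sum of `2⁻ⁿ`. Finiteness of the integrand at `x` then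
  -- forces increments of order `2^{-n/p}`, with no triangle inequality in `L^p`, so `p < 1` is
  -- covered.
  have hfin : ∫⁻ x, ∑' n, (2 : ℝ≥0∞) ^ n * ‖f (n + 1) x - f n x‖ₑ ^ p ∂μ ≠ ∞ := by
    rw [lintegral_tsum hm]
    refine ne_top_of_le_ne_top (b := ∑' n, (2⁻¹ : ℝ≥0∞) ^ n) ?_ (ENNReal.tsum_le_tsum fun n => ?_)
    · rw [ENNReal.tsum_geometric]
      simp
    · rw [lintegral_const_mul' _ _ (by simp)]
      calc (2 : ℝ≥0∞) ^ n * ∫⁻ x, ‖f (n + 1) x - f n x‖ₑ ^ p ∂μ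
          ≤ 2 ^ n * (4⁻¹) ^ n := by gcongr; exact h n
        _ = (2⁻¹) ^ n := by
            rw [← mul_pow]
            congr 1
            rw [show (4 : ℝ≥0∞) = 2 * 2 by norm_num,
              ENNReal.mul_inv (by simp) (by simp), ← mul_assoc,
              ENNReal.mul_inv_cancel (by simp) (by simp), one_mul]
  filter_upwards [ae_lt_top' (AEMeasurable.tsum hm) hfin] with x hx
  set S := ∑' n, (2 : ℝ≥0∞) ^ n * ‖f (n + 1) x - f n x‖ₑ ^ p with hS
  apply cauchySeq_tendsto_of_complete
  refine cauchySeq_of_le_geometric ((2⁻¹ : ℝ) ^ p⁻¹) (S.toReal ^ p⁻¹)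
    (Real.rpow_lt_one (by norm_num) (by norm_num) (inv_pos.2 hp)) fun n => ?_
  have h1 : (2 : ℝ≥0∞) ^ n * ‖f (n + 1) x - f n x‖ₑ ^ p ≤ S :=
    ENNReal.le_tsum (f := fun n => (2 : ℝ≥0∞) ^ n * ‖f (n + 1) x - f n x‖ₑ ^ p) n
  have h2 : (2 : ℝ) ^ n * ‖f (n + 1) x - f n x‖ ^ p ≤ S.toReal := by
    have := ENNReal.toReal_mono hx.ne h1
    simpa [ENNReal.toReal_mul, ← ENNReal.toReal_rpow] using this
  have h3 : ‖f (n + 1) x - f n x‖ ^ p ≤ S.toReal * (2⁻¹ : ℝ) ^ n := by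
    rw [inv_pow, ← div_eq_mul_inv, le_div_iff₀ (by positivity)]
    linarith
  rw [dist_comm, dist_eq_norm]
  calc ‖f (n + 1) x - f n x‖ = (‖f (n + 1) x - f n x‖ ^ p) ^ p⁻¹ := by
        rw [Real.rpow_rpow_inv (norm_nonneg _) hp.ne']
    _ ≤ (S.toReal * (2⁻¹ : ℝ) ^ n) ^ p⁻¹ :=
        Real.rpow_le_rpow (by positivity) h3 (inv_nonneg.2 hp.le)
    _ = S.toReal ^ p⁻¹ * ((2⁻¹ : ℝ) ^ p⁻¹) ^ n := by
        rw [Real.mul_rpow (by positivity) (by positivity), ← Real.rpow_natCast,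
          ← Real.rpow_natCast, ← Real.rpow_mul (by norm_num), ← Real.rpow_mul (by norm_num),
          mul_comm p⁻¹]

theorem eLpNorm_rpow_eq_lintegral {α F : Type*} [MeasurableSpace α] {μ : Measure α} [ENorm F]
    (hp : 0 < p) (f : α → F) :
    eLpNorm f (ENNReal.ofReal p) μ ^ p = ∫⁻ x, ‖f x‖ₑ ^ p ∂μ := by
  rw [eLpNorm_eq_lintegral_rpow_enorm_toReal (by simpa using hp) (by simp),
    ENNReal.toReal_ofReal hp.le, ← ENNReal.rpow_mul, one_div, inv_mul_cancel₀ hp.ne',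
    ENNReal.rpow_one]

theorem quasinorm_nonneg (f : WLp 𝕜 p w) : 0 ≤ ‖f‖ := ENNReal.toReal_nonneg

/-- The `q`-th power of the quasinorm of `L^p` is subadditive for `q = min p 1`. -/
theorem norm_add_rpow_le (hp : 0 < p) (f g : WLp 𝕜 p w) :
    ‖f + g‖ ^ min p 1 ≤ ‖f‖ ^ min p 1 + ‖g‖ ^ min p 1 := by
  have key : eLpNorm (f + g : WLp 𝕜 p w) (ENNReal.ofReal p) (wMeasure w) ^ min p 1 ≤
      eLpNorm f (ENNReal.ofReal p) (wMeasure w) ^ min p 1 +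
      eLpNorm g (ENNReal.ofReal p) (wMeasure w) ^ min p 1 := by
    rw [eLpNorm_congr_ae (Lp.coeFn_add f g)]
    rcases le_total p 1 with h | h
    · rw [min_eq_left h, eLpNorm_rpow_eq_lintegral hp, eLpNorm_rpow_eq_lintegral hp,
        eLpNorm_rpow_eq_lintegral hp,
        ← lintegral_add_left' ((Lp.aestronglyMeasurable f).enorm.pow_const p)]
      refine lintegral_mono fun x => ?_
      exact (ENNReal.rpow_le_rpow (enorm_add_le _ _) hp.le).trans
        (ENNReal.rpow_add_le_add_rpow _ _ hp.le h)
    · rw [min_eq_right h]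
      simp only [ENNReal.rpow_one]
      exact eLpNorm_add_le (Lp.aestronglyMeasurable f) (Lp.aestronglyMeasurable g)
        (by simpa using h)
  have hq : 0 ≤ min p 1 := le_min hp.le zero_le_one
  have := ENNReal.toReal_mono (by
    simp [ENNReal.add_eq_top, ENNReal.rpow_eq_top_iff_of_pos (lt_min hp one_pos),
      Lp.eLpNorm_ne_top]) key
  rw [ENNReal.toReal_add (ENNReal.rpow_ne_top_of_nonneg hq (Lp.eLpNorm_ne_top f))
    (ENNReal.rpow_ne_top_of_nonneg hq (Lp.eLpNorm_ne_top g))] at this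
  simpa only [← ENNReal.toReal_rpow, Lp.norm_def] using this

/-- The metric `‖f - g‖ ^ min p 1` on `L^p(w)`. -/
@[reducible] noncomputable def quasiMetric (hp : 0 < p) : PseudoMetricSpace (WLp 𝕜 p w) where
  dist f g := ‖f - g‖ ^ min p 1
  dist_self f := by
    have : min p 1 ≠ 0 := (lt_min hp one_pos).ne'
    simp [Real.zero_rpow this]
  dist_comm f g := by
    rw [← Lp.norm_neg, neg_sub]
  dist_triangle f g h := by
    simpa using norm_add_rpow_le hp (f - g) (g - h)

theorem rpow_lt_iff_lt_rpow_inv {a b q : ℝ} (ha : 0 ≤ a) (hb : 0 ≤ b) (hq : 0 < q) :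
    a ^ q < b ↔ a < b ^ q⁻¹ := by
  rw [Real.lt_rpow_inv_iff_of_pos ha hb hq]

/-- The map `s ↦ s ^ min p 1` is an increasing bijection of `[0, ∞)`, so metric balls are quasinorm
balls with another radius. -/
theorem quasiMetric_topology_eq (hp : 0 < p) :
    (quasiMetric hp : PseudoMetricSpace (WLp 𝕜 p w)).toUniformSpace.toTopologicalSpace =
      quasiNormTopology 𝕜 p w := by
  have hq : 0 < min p 1 := lt_min hp one_pos
  refine TopologicalSpace.ext_iff.2 fun U => ?_
  let _ := (quasiMetric hp : PseudoMetricSpace (WLp 𝕜 p w))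
  rw [Metric.isOpen_iff]
  refine forall₂_congr fun f _ => ⟨?_, ?_⟩
  · rintro ⟨ε, hε, h⟩
    exact ⟨ε ^ (min p 1)⁻¹, by positivity, fun g hg => h
      (Metric.mem_ball.2 ((rpow_lt_iff_lt_rpow_inv (quasinorm_nonneg _) hε.le hq).2 hg))⟩
  · rintro ⟨ε, hε, h⟩
    refine ⟨ε ^ min p 1, by positivity, fun g hg => h g ?_⟩
    exact (Real.rpow_lt_rpow_iff (quasinorm_nonneg _) hε.le hq).1 (Metric.mem_ball.1 hg)

/-- Riesz–Fischer: a rapidly Cauchy sequence converges almost everywhere, and Fatou's lemma carries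
the rate over to the limit. The control radii are those for which the `p`-th moments of the
increments are at most `4⁻ⁿ`. -/
theorem quasiMetric_completeSpace (hp : 0 < p) :
    @CompleteSpace (WLp 𝕜 p w) (quasiMetric hp).toUniformSpace := by
  have hq : 0 < min p 1 := lt_min hp one_pos
  let _ := (quasiMetric hp : PseudoMetricSpace (WLp 𝕜 p w))
  refine Metric.complete_of_convergent_controlled_sequences
    (fun n => (((4⁻¹ : ℝ) ^ n) ^ p⁻¹) ^ min p 1) (fun n => by positivity) fun u hu => ?_
  have hu' : ∀ N n m : ℕ, N ≤ n → N ≤ m → ‖u n - u m‖ < ((4⁻¹ : ℝ) ^ N) ^ p⁻¹ :=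
    fun N n m hn hm => (Real.rpow_lt_rpow_iff (quasinorm_nonneg _) (by positivity) hq).1 (hu N n m hn hm)
  have hu2 : ∀ N n m : ℕ, N ≤ n → N ≤ m → eLpNorm (⇑(u n) - ⇑(u m)) (ENNReal.ofReal p)
      (wMeasure w) ≤ ENNReal.ofReal (((4⁻¹ : ℝ) ^ N) ^ p⁻¹) := fun N n m hn hm => by
    rw [← eLpNorm_congr_ae (Lp.coeFn_sub _ _)]
    exact (ENNReal.le_ofReal_iff_toReal_le (Lp.eLpNorm_ne_top _) (by positivity)).2
      (hu' N n m hn hm).le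
  have hae : ∀ᵐ x ∂(wMeasure w), ∃ l, Tendsto (fun n => u n x) atTop (𝓝 l) := by
    refine ae_exists_tendsto_of_lintegral_increment_le hp
      (fun n => Lp.aestronglyMeasurable (u n)) fun n => ?_
    rw [← eLpNorm_rpow_eq_lintegral hp (fun x => u (n + 1) x - u n x)]
    refine (ENNReal.rpow_le_rpow (hu2 n (n + 1) n (by omega) le_rfl) hp.le).trans_eq ?_
    rw [ENNReal.ofReal_rpow_of_nonneg (by positivity) hp.le,
      Real.rpow_inv_rpow (by positivity) hp.ne', ENNReal.ofReal_pow (by norm_num),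
      ENNReal.ofReal_inv_of_pos (by norm_num)]
    norm_num
  obtain ⟨v, hv, hvt⟩ := exists_stronglyMeasurable_limit_of_tendsto_ae
    (fun n => Lp.aestronglyMeasurable (u n)) hae
  have hlim : ∀ n, eLpNorm (⇑(u n) - v) (ENNReal.ofReal p) (wMeasure w) ≤
      ENNReal.ofReal (((4⁻¹ : ℝ) ^ n) ^ p⁻¹) := fun n => by
    refine Lp.eLpNorm_le_of_ae_tendsto (u := atTop) (f := fun m => ⇑(u n) - ⇑(u m))
      (eventually_atTop.2 ⟨n, fun m hm => hu2 n n m le_rfl hm⟩)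
      (fun m => (Lp.aestronglyMeasurable _).sub (Lp.aestronglyMeasurable _)) ?_
    filter_upwards [hvt] with x hx
    exact hx.const_sub _
  have hv0 : MemLp v (ENNReal.ofReal p) (wMeasure w) := by
    have h1 : MemLp (⇑(u 0) - v) (ENNReal.ofReal p) (wMeasure w) :=
      ⟨(Lp.aestronglyMeasurable _).sub hv.aestronglyMeasurable,
        (hlim 0).trans_lt ENNReal.ofReal_lt_top⟩
    simpa using (Lp.memLp (u 0)).sub h1
  refine ⟨hv0.toLp v, ?_⟩
  rw [tendsto_iff_dist_tendsto_zero]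
  have hb : ∀ n, ‖u n - hv0.toLp v‖ ^ min p 1 ≤ (((4⁻¹ : ℝ) ^ p⁻¹) ^ min p 1) ^ n := fun n => by
    have h1 : ‖u n - hv0.toLp v‖ ≤ ((4⁻¹ : ℝ) ^ n) ^ p⁻¹ := by
      rw [Lp.norm_def]
      refine ENNReal.toReal_le_of_le_ofReal (by positivity) ?_
      refine le_trans (le_of_eq (eLpNorm_congr_ae ?_)) (hlim n)
      filter_upwards [Lp.coeFn_sub (u n) (hv0.toLp v), hv0.coeFn_toLp] with x h1 h2
      rw [h1, Pi.sub_apply, h2, Pi.sub_apply]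
    refine (Real.rpow_le_rpow (quasinorm_nonneg _) h1 hq.le).trans_eq ?_
    rw [← Real.rpow_natCast, ← Real.rpow_natCast, ← Real.rpow_mul (by positivity),
      ← Real.rpow_mul (by positivity), ← Real.rpow_mul (by positivity), ← Real.rpow_mul (by positivity)]
    ring_nf
  refine squeeze_zero (fun _ => Real.rpow_nonneg (quasinorm_nonneg _) _) hb (tendsto_pow_atTop_nhds_zero_of_lt_one
    (by positivity) (Real.rpow_lt_one (by positivity) ?_ hq))
  exact Real.rpow_lt_one (by norm_num) (by norm_num) (inv_pos.2 hp)

/-- Precompactness in `L^p(w)` is total boundedness for the quasinorm. -/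
theorem isPrecompact_iff (hp : 0 < p) (K : Set (WLp 𝕜 p w)) :
    IsPrecompact K ↔ ∀ ε : ℝ≥0∞, 0 < ε → ∃ t : Set (WLp 𝕜 p w), t.Finite ∧
      ∀ f ∈ K, ∃ g ∈ t, wNorm p w (⇑f - ⇑g) ≤ ε := by
  have hq : 0 < min p 1 := lt_min hp one_pos
  let _ := (quasiMetric hp : PseudoMetricSpace (WLp 𝕜 p w))
  have _ := (quasiMetric_completeSpace hp : CompleteSpace (WLp 𝕜 p w))
  have hN : ∀ f g : WLp 𝕜 p w, wNorm p w (⇑f - ⇑g) = ENNReal.ofReal ‖f - g‖ := fun f g => by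
    rw [Lp.norm_def, ENNReal.ofReal_toReal (Lp.eLpNorm_ne_top _), wNorm,
      eLpNorm_congr_ae (Lp.coeFn_sub _ _)]
  have h0 : IsPrecompact K ↔ TotallyBounded K := by
    unfold IsPrecompact
    rw [← quasiMetric_topology_eq hp]
    refine ⟨fun h => h.totallyBounded.subset subset_closure, fun h => ?_⟩
    refine isCompact_iff_totallyBounded_isComplete.2 ⟨h.closure, ?_⟩
    exact IsClosed.isComplete isClosed_closure
  rw [h0, Metric.totallyBounded_iff]
  constructor
  · intro h ε hε
    obtain ⟨δ, hδ, hδε⟩ := ENNReal.lt_iff_exists_real_btwn.1 hε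
    have hδ0 : 0 < δ := by simpa using hδε.1
    obtain ⟨t, ht, hK⟩ := h (δ ^ min p 1) (by positivity)
    refine ⟨t, ht, fun f hf => ?_⟩
    obtain ⟨g, hg, hfg⟩ := mem_iUnion₂.1 (hK hf)
    refine ⟨g, hg, ?_⟩
    rw [hN]
    refine le_trans (ENNReal.ofReal_le_ofReal ?_) hδε.2.le
    exact ((Real.rpow_lt_rpow_iff (quasinorm_nonneg _) hδ hq).1 (Metric.mem_ball.1 hfg)).le
  · intro h ε hε
    obtain ⟨t, ht, hK⟩ := h (ENNReal.ofReal (ε ^ (min p 1)⁻¹ / 2)) (by simp; positivity)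
    refine ⟨t, ht, fun f hf => ?_⟩
    obtain ⟨g, hg, hfg⟩ := hK f hf
    refine mem_iUnion₂.2 ⟨g, hg, Metric.mem_ball.2
      ((rpow_lt_iff_lt_rpow_inv (quasinorm_nonneg _) hε.le hq).2 ?_)⟩
    rw [hN, ENNReal.ofReal_le_ofReal_iff (by positivity)] at hfg
    have : 0 < ε ^ (min p 1)⁻¹ := by positivity
    linarith

end Quasinorm

end BiParam

namespace BiParam

/-! ### `A_p` weights: local integrability and uniform bounds for averages -/

section Weights

variable {n₁ n₂ : ℕ} {p q r : ℝ} {w : Space n₁ n₂ → ℝ≥0∞}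

instance instIsAddHaarMeasureSpace :
    (volume : Measure (Space n₁ n₂)).IsAddHaarMeasure :=
  Measure.prod.instIsAddHaarMeasure _ _

instance instIsNegInvariantSpace : (volume : Measure (Space n₁ n₂)).IsNegInvariant := by
  have : (volume : Measure (Space n₁ n₂)).Regular := inferInstance
  infer_instance

theorem ball_subset_metricBall (x : Space n₁ n₂) (r : ℝ) : ball x r ⊆ Metric.ball x r := by
  intro y hy
  have hy : ‖y.1 - x.1‖ + ‖y.2 - x.2‖ < r := hy
  rw [Metric.mem_ball, dist_eq_norm, Prod.norm_def]
  exact max_lt (by simpa using by linarith [norm_nonneg (y.2 - x.2)])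
    (by simpa using by linarith [norm_nonneg (y.1 - x.1)])

theorem metricBall_subset_ball (x : Space n₁ n₂) (r : ℝ) : Metric.ball x (r / 2) ⊆ ball x r := by
  intro y hy
  rw [Metric.mem_ball, dist_eq_norm, Prod.norm_def, max_lt_iff] at hy
  have h1 : ‖y.1 - x.1‖ < r / 2 := hy.1
  have h2 : ‖y.2 - x.2‖ < r / 2 := hy.2
  change ‖y.1 - x.1‖ + ‖y.2 - x.2‖ < r
  linarith

theorem isOpen_ball (x : Space n₁ n₂) (r : ℝ) : IsOpen (ball x r) :=
  isOpen_lt (by fun_prop) continuous_const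

theorem measurableSet_ball (x : Space n₁ n₂) (r : ℝ) : MeasurableSet (ball x r) :=
  (isOpen_ball x r).measurableSet

theorem volume_ball_pos (x : Space n₁ n₂) (hr : 0 < r) : 0 < volume (ball x r) :=
  (Metric.measure_ball_pos volume x (half_pos hr)).trans_le
    (measure_mono (metricBall_subset_ball x r))

theorem volume_ball_lt_top (x : Space n₁ n₂) (r : ℝ) : volume (ball x r) < ∞ :=
  (measure_mono (ball_subset_metricBall x r)).trans_lt measure_ball_lt_top

theorem sub_preimage_ball (x : Space n₁ n₂) (r : ℝ) :
    (fun y => x - y) ⁻¹' ball x r = ball 0 r := by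
  ext y
  simp [ball]

/-- The reflected translate of an average over `B(0, r)` is an average over `B(x, r)`. -/
theorem setLIntegral_ball_zero_comp_sub (x : Space n₁ n₂) (r : ℝ) (G : Space n₁ n₂ → ℝ≥0∞) :
    ∫⁻ y in ball 0 r, G (x - y) = ∫⁻ z in ball x r, G z := by
  rw [← sub_preimage_ball x r]
  exact (Measure.measurePreserving_sub_left volume x).setLIntegral_comp_preimage_emb
    (MeasurableEquiv.subLeft x).measurableEmbedding G (ball x r)

theorem volume_ball (x : Space n₁ n₂) (r : ℝ) :
    volume (ball x r) = volume (ball (0 : Space n₁ n₂) r) := by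
  have := setLIntegral_ball_zero_comp_sub x r fun _ => 1
  simpa using this.symm

/-- The closed-open box with centre `u` and side lengths `2ρ`. -/
def box (u : Space n₁ n₂) (ρ : ℝ) : Set (Space n₁ n₂) :=
  cube (fun i => u.1 i - ρ) (2 * ρ) ×ˢ cube (fun i => u.2 i - ρ) (2 * ρ)

theorem metricBall_subset_box (u : Space n₁ n₂) (ρ : ℝ) : Metric.ball u ρ ⊆ box u ρ := by
  rcases le_or_gt ρ 0 with h | h
  · simp [Metric.ball_eq_empty.2 h]
  intro y hy
  rw [← ball_prod_same, mem_prod, ball_pi _ h, ball_pi _ h] at hy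
  simp only [box, cube, mem_prod, Set.mem_pi, mem_univ, true_implies, Metric.mem_ball, Real.dist_eq,
    abs_lt, mem_Ico] at hy ⊢
  exact ⟨fun i => ⟨by linarith [(hy.1 i).1], by linarith [(hy.1 i).2]⟩,
    fun i => ⟨by linarith [(hy.2 i).1], by linarith [(hy.2 i).2]⟩⟩

theorem box_subset_closedBall (u : Space n₁ n₂) {ρ : ℝ} (hρ : 0 ≤ ρ) :
    box u ρ ⊆ Metric.closedBall u ρ := by
  intro y hy
  rw [← closedBall_prod_same, mem_prod, closedBall_pi _ hρ, closedBall_pi _ hρ]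
  simp only [box, cube, mem_prod, Set.mem_pi, mem_univ, true_implies, Metric.mem_closedBall,
    Real.dist_eq, abs_le, mem_Ico] at hy ⊢
  exact ⟨fun i => ⟨by linarith [(hy.1 i).1], by linarith [(hy.1 i).2]⟩,
    fun i => ⟨by linarith [(hy.2 i).1], by linarith [(hy.2 i).2]⟩⟩

/-- The box lies between the open and the closed sup-norm ball, which have equal volume. Sup-norm
balls can therefore replace cubes from here on. -/
theorem volume_box (u : Space n₁ n₂) {ρ : ℝ} (hρ : 0 < ρ) :
    volume (box u ρ) = volume (Metric.ball u ρ) := by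
  refine le_antisymm ((measure_mono (box_subset_closedBall u hρ.le)).trans_eq ?_)
    (measure_mono (metricBall_subset_box u ρ))
  rw [Measure.addHaar_closedBall _ _ hρ.le, Measure.addHaar_ball_of_pos _ _ hρ]

/-- The `A_p` condition on the cube with centre `u` and side length `2ρ`. -/
theorem wMeasure_metricBall_mul_le (hp : 1 < p) (w : Space n₁ n₂ → ℝ≥0∞) (u : Space n₁ n₂) {ρ : ℝ}
    (hρ : 0 < ρ) :
    wMeasure w (Metric.ball u ρ) *
        (∫⁻ x in Metric.ball u ρ, w x ^ (1 - p.conjExponent)) ^ (p - 1) ≤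
      apConst p w * volume (Metric.ball u ρ) ^ p := by
  have hR : box u ρ ∈ rectangles n₁ n₂ :=
    ⟨_, 2 * ρ, _, 2 * ρ, by linarith, by linarith, rfl⟩
  have h := le_iSup₂ (f := fun R (_ : R ∈ rectangles n₁ n₂) =>
    (⨍⁻ x in R, w x ∂volume) * (⨍⁻ x in R, w x ^ (1 - p.conjExponent) ∂volume) ^ (p - 1)) _ hR
  change _ ≤ apConst p w at h
  simp only [setLAverage_eq, volume_box u hρ] at h
  set V := volume (Metric.ball u ρ) with hV
  have hV0 : V ≠ 0 := (Metric.measure_ball_pos volume u hρ).ne'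
  have hVt : V ≠ ∞ := measure_ball_lt_top.ne
  have hp1 : 0 ≤ p - 1 := by linarith
  rw [ENNReal.div_rpow_of_nonneg _ _ hp1, ← ENNReal.mul_div_mul_comm (Or.inl hV0) (Or.inl hVt),
    show V * V ^ (p - 1) = V ^ p by
      nth_rw 1 [← ENNReal.rpow_one V]
      rw [← ENNReal.rpow_add _ _ hV0 hVt]
      congr 1
      ring,
    ENNReal.div_le_iff (by simp [hV0, hVt]) (by simp [hV0, hVt])] at h
  refine le_trans ?_ h
  rw [withDensity_apply _ Metric.isOpen_ball.measurableSet]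
  have hs := metricBall_subset_box u ρ
  gcongr

theorem IsWeight.lintegral_rpow_metricBall_pos (hw : IsWeight w) (s : ℝ) (u : Space n₁ n₂) {ρ : ℝ}
    (hρ : 0 < ρ) : 0 < ∫⁻ x in Metric.ball u ρ, w x ^ s := by
  rw [pos_iff_ne_zero, Ne, lintegral_eq_zero_iff' (hw.1.restrict.pow_const s)]
  intro h
  have h2 : ∀ᵐ x ∂(volume.restrict (Metric.ball u ρ)), False := by
    filter_upwards [h, ae_restrict_of_ae hw.2] with x h1 h2
    simp only [Pi.zero_apply, ENNReal.rpow_eq_zero_iff] at h1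
    rcases h1 with h1 | h1
    · exact h2.1.ne' h1.1
    · exact h2.2.ne h1.1
  rw [eventually_false_iff_eq_bot, ae_eq_bot, Measure.restrict_eq_zero] at h2
  exact (Metric.measure_ball_pos volume u hρ).ne' h2

theorem IsWeight.wMeasure_metricBall_pos (hw : IsWeight w) (u : Space n₁ n₂) {ρ : ℝ}
    (hρ : 0 < ρ) : 0 < wMeasure w (Metric.ball u ρ) := by
  rw [withDensity_apply _ Metric.isOpen_ball.measurableSet]
  simpa using hw.lintegral_rpow_metricBall_pos 1 u hρ

/-- In the `A_p` product the dual factor is nonzero because `0 < w < ∞` almost everywhere, so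
finiteness of the product forces finiteness of the other factor. The dual weight is treated
symmetrically. -/
theorem IsAp.wMeasure_metricBall_lt_top (hp : 1 < p) (hw : IsAp p w) (u : Space n₁ n₂) (ρ : ℝ) :
    wMeasure w (Metric.ball u ρ) < ∞ := by
  rcases le_or_gt ρ 0 with h | hρ
  · simp [Metric.ball_eq_empty.2 h]
  have h := wMeasure_metricBall_mul_le hp w u hρ
  have ht : apConst p w * volume (Metric.ball u ρ) ^ p < ∞ :=
    ENNReal.mul_lt_top hw.2 (ENNReal.rpow_lt_top_of_nonneg (by linarith) measure_ball_lt_top.ne)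
  have h0 := hw.1.lintegral_rpow_metricBall_pos (1 - p.conjExponent) u hρ
  exact ENNReal.lt_top_of_mul_ne_top_left (h.trans_lt ht).ne
    (by simp [h0.ne', not_lt.2 hp.le])

theorem IsAp.lintegral_dual_metricBall_lt_top (hp : 1 < p) (hw : IsAp p w) (u : Space n₁ n₂)
    (ρ : ℝ) : ∫⁻ x in Metric.ball u ρ, w x ^ (1 - p.conjExponent) < ∞ := by
  rcases le_or_gt ρ 0 with h | hρ
  · simp [Metric.ball_eq_empty.2 h]
  have h := wMeasure_metricBall_mul_le hp w u hρ
  have ht : apConst p w * volume (Metric.ball u ρ) ^ p < ∞ :=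
    ENNReal.mul_lt_top hw.2 (ENNReal.rpow_lt_top_of_nonneg (by linarith) measure_ball_lt_top.ne)
  have h2 := ENNReal.lt_top_of_mul_ne_top_right (h.trans_lt ht).ne
    (hw.1.wMeasure_metricBall_pos u hρ).ne'
  exact (ENNReal.rpow_lt_top_iff_of_pos (by linarith)).1 h2

theorem IsAp.isLocallyFiniteMeasure (hp : 1 < p) (hw : IsAp p w) :
    IsLocallyFiniteMeasure (wMeasure w) :=
  ⟨fun x => ⟨Metric.ball x 1, Metric.ball_mem_nhds x one_pos,
    hw.wMeasure_metricBall_lt_top hp x 1⟩⟩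

/-- Hölder's inequality between `L^p(w)` and the dual weight. -/
theorem IsWeight.lintegral_rpow_le (hp : 1 < p) (hw : IsWeight w) {E : Set (Space n₁ n₂)}
    (hE : MeasurableSet E) {g : Space n₁ n₂ → ℝ≥0∞} (hg : AEMeasurable g volume) :
    (∫⁻ x in E, g x) ^ p ≤
      (∫⁻ x in E, g x ^ p ∂(wMeasure w)) *
        (∫⁻ x in E, w x ^ (1 - p.conjExponent)) ^ (p - 1) := by
  have hpq := Real.HolderConjugate.conjExponent hp
  have hp0 : 0 < p := by linarith
  have hp1 : 0 < p - 1 := by linarith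
  have hq : p.conjExponent = p / (p - 1) := rfl
  -- Split `g = (g w^{1/p}) w^{-1/p}`; the exponent of the dual weight arises from `-p'/p = 1 - p'`.
  have h := ENNReal.lintegral_mul_le_Lp_mul_Lq (volume.restrict E) hpq
    (f := fun x => g x * w x ^ p⁻¹) (g := fun x => w x ^ (-p⁻¹))
    (hg.restrict.mul (hw.1.restrict.pow_const _)) (hw.1.restrict.pow_const _)
  have h1 : ∫⁻ x in E, ((fun x => g x * w x ^ p⁻¹) * fun x => w x ^ (-p⁻¹)) x = ∫⁻ x in E, g x := by
    refine lintegral_congr_ae ?_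
    filter_upwards [ae_restrict_of_ae hw.2] with x hx
    simp only [Pi.mul_apply]
    rw [mul_assoc, ← ENNReal.rpow_add _ _ hx.1.ne' hx.2.ne, add_neg_cancel, ENNReal.rpow_zero,
      mul_one]
  have h2 : ∫⁻ x in E, (g x * w x ^ p⁻¹) ^ p = ∫⁻ x in E, g x ^ p ∂(wMeasure w) := by
    rw [setLIntegral_withDensity_eq_lintegral_mul₀ hw.1 (hg.pow_const p) hE]
    refine lintegral_congr fun x => ?_
    rw [ENNReal.mul_rpow_of_nonneg _ _ hp0.le, ← ENNReal.rpow_mul, inv_mul_cancel₀ hp0.ne',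
      ENNReal.rpow_one, Pi.mul_apply, mul_comm]
  have h3 : ∫⁻ x in E, (w x ^ (-p⁻¹)) ^ p.conjExponent =
      ∫⁻ x in E, w x ^ (1 - p.conjExponent) := by
    refine lintegral_congr fun x => ?_
    rw [← ENNReal.rpow_mul]
    congr 1
    rw [hq]
    field_simp
    ring
  rw [h1, h2, h3] at h
  refine (ENNReal.rpow_le_rpow h hp0.le).trans_eq ?_
  rw [ENNReal.mul_rpow_of_nonneg _ _ hp0.le, ← ENNReal.rpow_mul, ← ENNReal.rpow_mul, one_div,
    inv_mul_cancel₀ hp0.ne', ENNReal.rpow_one]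
  congr 2
  rw [hq]
  field_simp

/-- Weighted Jensen inequality on cubes for `A_p` weights and exponents `q ≥ p`. -/
theorem IsAp.wMeasure_metricBall_mul_lintegral_rpow_le (hp : 1 < p) (hpq : p ≤ q) (hw : IsAp p w)
    (u : Space n₁ n₂) {ρ : ℝ} (hρ : 0 < ρ) {g : Space n₁ n₂ → ℝ≥0∞} (hg : Measurable g) :
    wMeasure w (Metric.ball u ρ) * (∫⁻ x in Metric.ball u ρ, g x) ^ q ≤
      apConst p w * volume (Metric.ball u ρ) ^ q *
        ∫⁻ x in Metric.ball u ρ, g x ^ q ∂(wMeasure w) := by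
  have hp0 : 0 < p := by linarith
  have hs : 1 ≤ q / p := (one_le_div hp0).2 hpq
  have hq0 : 0 < q := by linarith
  set B := Metric.ball u ρ with hB
  have hBm : MeasurableSet B := Metric.isOpen_ball.measurableSet
  set V := volume B with hV
  have hV0 : V ≠ 0 := (Metric.measure_ball_pos volume u hρ).ne'
  have hVt : V ≠ ∞ := measure_ball_lt_top.ne
  -- Unweighted Jensen with exponent `q / p ≥ 1`. Hölder and `A_p` are then applied to `g ^ (q /
  -- p)`, which settles all `q ≥ p` at once.
  have hJ : (∫⁻ x in B, g x) ^ q ≤ (∫⁻ x in B, g x ^ (q / p)) ^ p * V ^ (q - p) := by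
    have h := eLpNorm'_le_eLpNorm'_mul_rpow_measure_univ (μ := volume.restrict B) one_pos hs
      hg.aestronglyMeasurable
    simp only [eLpNorm'_eq_lintegral_enorm, enorm_eq_self, ENNReal.rpow_one, Measure.restrict_apply,
      MeasurableSet.univ, univ_inter, div_one] at h
    refine (ENNReal.rpow_le_rpow h (by linarith)).trans_eq ?_
    rw [ENNReal.mul_rpow_of_nonneg _ _ (by linarith), ← ENNReal.rpow_mul, ← ENNReal.rpow_mul]
    congr 2
    · rw [one_div_div, div_mul_cancel₀ _ hq0.ne']
    · rw [one_div_div, sub_mul, one_mul, div_mul_cancel₀ _ hq0.ne']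
  have hH := hw.1.lintegral_rpow_le hp hBm (hg.pow_const (q / p)).aemeasurable
  have hA := wMeasure_metricBall_mul_le hp w u hρ
  have hpow : ∀ x, (g x ^ (q / p)) ^ p = g x ^ q := fun x => by
    rw [← ENNReal.rpow_mul, div_mul_cancel₀ _ hp0.ne']
  simp only [hpow] at hH
  set I := ∫⁻ x in B, g x ^ q ∂(wMeasure w)
  set S := (∫⁻ x in B, w x ^ (1 - p.conjExponent)) ^ (p - 1)
  calc wMeasure w B * (∫⁻ x in B, g x) ^ q
      ≤ wMeasure w B * ((I * S) * V ^ (q - p)) := by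
        gcongr
        exact hJ.trans (by gcongr)
    _ = (wMeasure w B * S) * V ^ (q - p) * I := by ring
    _ ≤ (apConst p w * V ^ p) * V ^ (q - p) * I := by gcongr
    _ = apConst p w * V ^ q * I := by
        rw [mul_assoc (apConst p w), ← ENNReal.rpow_add _ _ hV0 hVt]
        congr 3
        ring

/-- Integration over all cubes of a fixed size. -/
theorem lintegral_lintegral_metricBall (w : Space n₁ n₂ → ℝ≥0∞) (ρ : ℝ) {F : Space n₁ n₂ → ℝ≥0∞}
    (hF : Measurable F) :
    ∫⁻ u, ∫⁻ x in Metric.ball u ρ, F x ∂(wMeasure w) =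
      volume (Metric.ball (0 : Space n₁ n₂) ρ) * ∫⁻ x, F x ∂(wMeasure w) := by
  have hm : MeasurableSet {z : Space n₁ n₂ × Space n₁ n₂ | dist z.2 z.1 < ρ} :=
    (isOpen_lt (by fun_prop) continuous_const).measurableSet
  have h1 : ∀ u, ∫⁻ x in Metric.ball u ρ, F x ∂(wMeasure w) =
      ∫⁻ x, (Metric.ball u ρ).indicator F x ∂(wMeasure w) := fun u =>
    (lintegral_indicator Metric.isOpen_ball.measurableSet F).symm
  simp only [h1]
  rw [lintegral_lintegral_swap (f := fun u x => (Metric.ball u ρ).indicator F x)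
    ((Measurable.indicator (hF.comp measurable_snd) hm).aemeasurable),
    ← lintegral_const_mul _ hF]
  refine lintegral_congr fun x => ?_
  -- By symmetry of the distance, each `x` is counted by the centres `u` in the ball of radius `ρ`
  -- about `x`.
  have h2 : ∀ u, (Metric.ball u ρ).indicator F x = (Metric.ball x ρ).indicator (fun _ => F x) u :=
    fun u => by
      by_cases h : dist x u < ρ
      · rw [indicator_of_mem (Metric.mem_ball.2 h), indicator_of_mem]
        rwa [Metric.mem_ball, dist_comm]
      · rw [indicator_of_notMem (by simpa using h), indicator_of_notMem]
        rw [Metric.mem_ball, dist_comm]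
        exact h
  simp only [h2]
  rw [lintegral_indicator_const Metric.isOpen_ball.measurableSet, Measure.addHaar_ball_center,
    mul_comm]

/-- The averages over the balls `B(x, r)` are bounded on `L^q(w)`, uniformly in `r`. -/
theorem IsAp.exists_lintegral_average_rpow_le (hp : 1 < p) (hpq : p ≤ q) (hw : IsAp p w) :
    ∃ C : ℝ≥0∞, C ≠ ∞ ∧ ∀ r : ℝ, 0 < r → ∀ G : Space n₁ n₂ → ℝ≥0∞, Measurable G →
      ∫⁻ x, (⨍⁻ y in ball 0 r, G (x - y) ∂volume) ^ q ∂(wMeasure w) ≤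
        C * ∫⁻ x, G x ^ q ∂(wMeasure w) := by
  set N := Module.finrank ℝ (Space n₁ n₂)
  have hq0 : 0 < q := by linarith
  -- `4 ^ N` compares the sup-norm ball of radius `2r` with `ball x r`, which contains the sup-norm
  -- ball of radius `r / 2`; `2 ^ N` comes from the doubled radius when integrating over centres.
  refine ⟨apConst p w * ENNReal.ofReal (4 ^ N) ^ q * ENNReal.ofReal (2 ^ N), ?_, fun r hr G hG => ?_⟩
  · exact ENNReal.mul_ne_top (ENNReal.mul_ne_top hw.2.ne (ENNReal.rpow_ne_top_of_nonneg hq0.le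
      ENNReal.ofReal_ne_top)) ENNReal.ofReal_ne_top
  set b := volume (ball (0 : Space n₁ n₂) r) with hb
  have hb0 : b ≠ 0 := (volume_ball_pos 0 hr).ne'
  have hbt : b ≠ ∞ := (volume_ball_lt_top 0 r).ne
  set V := volume (Metric.ball (0 : Space n₁ n₂) r) with hV
  have hV0 : V ≠ 0 := (Metric.measure_ball_pos volume _ hr).ne'
  have hVt : V ≠ ∞ := measure_ball_lt_top.ne
  have hV2 : ∀ u : Space n₁ n₂, volume (Metric.ball u (2 * r)) = ENNReal.ofReal (2 ^ N) * V :=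
    fun u => Measure.addHaar_ball_mul_of_pos volume u two_pos r
  have hVb : ∀ u : Space n₁ n₂, volume (Metric.ball u (2 * r)) ≤ ENNReal.ofReal (4 ^ N) * b := by
    intro u
    have := Measure.addHaar_ball_mul_of_pos volume u (show (0 : ℝ) < 4 by norm_num) (r / 2)
    rw [show 4 * (r / 2) = 2 * r by ring] at this
    rw [this]
    exact mul_le_mul_right (measure_mono (metricBall_subset_ball 0 r)) _
  have hmG : Measurable fun x => ⨍⁻ y in ball 0 r, G (x - y) ∂volume := by
    simp only [setLAverage_eq]
    refine Measurable.div_const (Measurable.lintegral_prod_right' (f := fun z : Space n₁ n₂ ×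
      Space n₁ n₂ => G (z.1 - z.2)) (hG.comp (by fun_prop))) _
  -- For `x` within `r` of `u`, every average over `ball x r` is at most `J / b`, a constant in `x`.
  have key : ∀ u : Space n₁ n₂,
      ∫⁻ x in Metric.ball u r, (⨍⁻ y in ball 0 r, G (x - y) ∂volume) ^ q ∂(wMeasure w) ≤
        apConst p w * ENNReal.ofReal (4 ^ N) ^ q *
          ∫⁻ x in Metric.ball u (2 * r), G x ^ q ∂(wMeasure w) := by
    intro u
    set J := ∫⁻ z in Metric.ball u (2 * r), G z
    calc ∫⁻ x in Metric.ball u r, (⨍⁻ y in ball 0 r, G (x - y) ∂volume) ^ q ∂(wMeasure w)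
        ≤ ∫⁻ x in Metric.ball u r, (J / b) ^ q ∂(wMeasure w) := by
          refine setLIntegral_mono' Metric.isOpen_ball.measurableSet fun x hx => ?_
          rw [setLAverage_eq, setLIntegral_ball_zero_comp_sub]
          have hs : ball x r ⊆ Metric.ball u (2 * r) :=
            (ball_subset_metricBall x r).trans (Metric.ball_subset_ball' (by
              rw [Metric.mem_ball] at hx; linarith))
          gcongr
          exact lintegral_mono_set hs
      _ ≤ (wMeasure w (Metric.ball u (2 * r)) * J ^ q) / b ^ q := by
          rw [setLIntegral_const, ENNReal.div_rpow_of_nonneg _ _ hq0.le, mul_comm, mul_div_assoc]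
          gcongr
          linarith
      _ ≤ (apConst p w * volume (Metric.ball u (2 * r)) ^ q *
            ∫⁻ x in Metric.ball u (2 * r), G x ^ q ∂(wMeasure w)) / b ^ q := by
          refine ENNReal.div_le_div_right ?_ _
          exact hw.wMeasure_metricBall_mul_lintegral_rpow_le hp hpq u (by linarith) hG
      _ ≤ (apConst p w * (ENNReal.ofReal (4 ^ N) * b) ^ q *
            ∫⁻ x in Metric.ball u (2 * r), G x ^ q ∂(wMeasure w)) / b ^ q := by
          gcongr
          exact hVb u
      _ = _ := by
          have hbq0 : b ^ q ≠ 0 := by simp [hb0, hbt, hq0]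
          have hbqt : b ^ q ≠ ∞ := by simp [hb0, hbt, hq0]
          rw [ENNReal.mul_rpow_of_nonneg _ _ hq0.le]
          set I := ∫⁻ x in Metric.ball u (2 * r), G x ^ q ∂(wMeasure w)
          rw [show apConst p w * (ENNReal.ofReal (4 ^ N) ^ q * b ^ q) * I =
            (apConst p w * ENNReal.ofReal (4 ^ N) ^ q * I) * b ^ q by ring,
            ENNReal.mul_div_cancel_right hbq0 hbqt]
  have h := lintegral_mono (μ := volume) key
  rw [lintegral_lintegral_metricBall w r (hmG.pow_const q), lintegral_const_mul' _ _
    (ENNReal.mul_ne_top hw.2.ne (ENNReal.rpow_ne_top_of_nonneg hq0.le ENNReal.ofReal_ne_top)),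
    lintegral_lintegral_metricBall w (2 * r) (hG.pow_const q), hV2] at h
  rw [← ENNReal.mul_le_mul_iff_right hV0 hVt]
  refine h.trans_eq ?_
  ring

end Weights

end BiParam

namespace BiParam

/-! ### Necessity: finite nets and translation means -/

section Necessity

variable {𝕜 : Type*} [RCLike 𝕜] {n₁ n₂ : ℕ} {p p₀ a r : ℝ} {w : Space n₁ n₂ → ℝ≥0∞}

theorem add_rpow_le_two_rpow_mul (A B : ℝ≥0∞) {q : ℝ} (hq : 0 ≤ q) :
    (A + B) ^ q ≤ 2 ^ q * (A ^ q + B ^ q) := by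
  calc (A + B) ^ q ≤ (2 * max A B) ^ q := by
        refine ENNReal.rpow_le_rpow ?_ hq
        rw [two_mul]
        exact add_le_add (le_max_left _ _) (le_max_right _ _)
    _ = 2 ^ q * (max A B) ^ q := ENNReal.mul_rpow_of_nonneg _ _ hq
    _ ≤ 2 ^ q * (A ^ q + B ^ q) := by
        gcongr
        rcases le_total A B with h | h
        · rw [max_eq_right h]; exact le_add_self
        · rw [max_eq_left h]; exact le_self_add

theorem wNorm_rpow {F : Type*} [ENorm F] (hp : 0 < p) (w : Space n₁ n₂ → ℝ≥0∞)
    (f : Space n₁ n₂ → F) : wNorm p w f ^ p = ∫⁻ x, ‖f x‖ₑ ^ p ∂(wMeasure w) :=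
  eLpNorm_rpow_eq_lintegral hp f

theorem wNorm_le_iff {F : Type*} [ENorm F] (hp : 0 < p) (w : Space n₁ n₂ → ℝ≥0∞)
    (f : Space n₁ n₂ → F) (ε : ℝ≥0∞) :
    wNorm p w f ≤ ε ↔ ∫⁻ x, ‖f x‖ₑ ^ p ∂(wMeasure w) ≤ ε ^ p := by
  rw [← wNorm_rpow hp, ENNReal.rpow_le_rpow_iff hp]

/-- The conditions are used as uniform bounds on `p`-th moments, which add up over disjoint regions
and avoid the missing triangle inequality for `p < 1`. -/
theorem tendsto_iSup_wNorm_iff {ι F X : Type*} [ENorm F] {l : Filter ι} (hp : 0 < p) {K : Set X}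
    (Φ : ι → X → Space n₁ n₂ → F) :
    Tendsto (fun i => ⨆ f ∈ K, wNorm p w (Φ i f)) l (𝓝 0) ↔
      ∀ ε : ℝ≥0∞, 0 < ε → ∀ᶠ i in l, ∀ f ∈ K, ∫⁻ x, ‖Φ i f x‖ₑ ^ p ∂(wMeasure w) ≤ ε := by
  rw [ENNReal.tendsto_nhds_zero]
  simp only [iSup₂_le_iff, wNorm_le_iff hp]
  constructor
  · intro h ε hε
    have := h (ε ^ p⁻¹) (by positivity)
    simpa only [ENNReal.rpow_inv_rpow hp.ne'] using this
  · intro h ε hε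
    exact h (ε ^ p) (ENNReal.rpow_pos_of_nonneg hε hp.le)

theorem lintegral_rpow_lt_top (hp : 0 < p) (f : WLp 𝕜 p w) :
    ∫⁻ x, ‖f x‖ₑ ^ p ∂(wMeasure w) < ∞ := by
  rw [← wNorm_rpow hp]
  exact ENNReal.rpow_lt_top_of_nonneg hp.le (Lp.eLpNorm_ne_top f)

/-- The quasi-triangle inequality for `p`-th moments. -/
theorem lintegral_rpow_le_of_enorm_le_add {α : Type*} [MeasurableSpace α] {μ : Measure α}
    (hp : 0 ≤ p) {F G H : α → ℝ≥0∞} (hG : AEMeasurable G μ) (h : ∀ x, F x ≤ G x + H x) :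
    ∫⁻ x, F x ^ p ∂μ ≤ 2 ^ p * (∫⁻ x, G x ^ p ∂μ + ∫⁻ x, H x ^ p ∂μ) := by
  rw [← lintegral_add_left' (hG.pow_const p), ← lintegral_const_mul' _ _ (by simp)]
  exact lintegral_mono fun x =>
    (ENNReal.rpow_le_rpow (h x) hp).trans (add_rpow_le_two_rpow_mul _ _ hp)

theorem IsPrecompact.exists_net (hp : 0 < p) {K : Set (WLp 𝕜 p w)} (hK : IsPrecompact K)
    {ε : ℝ≥0∞} (hε : 0 < ε) :
    ∃ t : Set (WLp 𝕜 p w), t.Finite ∧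
      ∀ f ∈ K, ∃ g ∈ t, ∫⁻ x, ‖f x - g x‖ₑ ^ p ∂(wMeasure w) ≤ ε := by
  obtain ⟨t, ht, h⟩ := (isPrecompact_iff hp K).1 hK (ε ^ p⁻¹) (by positivity)
  refine ⟨t, ht, fun f hf => ?_⟩
  obtain ⟨g, hg, hfg⟩ := h f hf
  rw [wNorm_le_iff hp, ENNReal.rpow_inv_rpow hp.ne'] at hfg
  exact ⟨g, hg, hfg⟩

theorem IsPrecompact.uniformlyBounded (hp : 0 < p) {K : Set (WLp 𝕜 p w)} (hK : IsPrecompact K) :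
    UniformlyBounded K := by
  obtain ⟨t, ht, h⟩ := hK.exists_net hp one_pos
  -- The sum over the finite net stands in for its maximum.
  set C : ℝ≥0∞ := 2 ^ p * (∑ g ∈ ht.toFinset, ∫⁻ x, ‖g x‖ₑ ^ p ∂(wMeasure w) + 1) with hC
  have hCt : C < ∞ := by
    refine ENNReal.mul_lt_top (ENNReal.rpow_lt_top_of_nonneg hp.le (by simp)) (ENNReal.add_lt_top.2 ⟨?_, by simp⟩)
    exact ENNReal.sum_lt_top.2 fun g _ => lintegral_rpow_lt_top hp g
  refine lt_of_le_of_lt (b := C ^ p⁻¹) (iSup₂_le fun f hf => ?_)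
    (ENNReal.rpow_lt_top_of_nonneg (by positivity) hCt.ne)
  rw [wNorm_le_iff hp, ENNReal.rpow_inv_rpow hp.ne']
  obtain ⟨g, hg, hfg⟩ := h f hf
  refine (lintegral_rpow_le_of_enorm_le_add hp.le (Lp.aestronglyMeasurable g).enorm
    (H := fun x => ‖f x - g x‖ₑ) fun x => ?_).trans ?_
  · refine le_trans (le_of_eq ?_) (enorm_add_le (g x) (f x - g x))
    rw [add_sub_cancel]
  · rw [hC]
    gcongr
    exact Finset.single_le_sum (f := fun g : WLp 𝕜 p w => ∫⁻ x, ‖g x‖ₑ ^ p ∂(wMeasure w))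
      (fun _ _ => zero_le) (ht.mem_toFinset.2 hg)

/-- A family of functionals that is stable under small perturbations and tends to zero pointwise
tends to zero uniformly on precompact sets. -/
theorem IsPrecompact.eventually_forall_le {ι : Type*} {l : Filter ι} (hp : 0 < p)
    {K : Set (WLp 𝕜 p w)} (hK : IsPrecompact K) {Ψ : ι → WLp 𝕜 p w → ℝ≥0∞} {C : ℝ≥0∞}
    (hC : C ≠ ∞)
    (hΨ : ∀ᶠ i in l, ∀ f g, Ψ i f ≤ C * (Ψ i g + ∫⁻ x, ‖f x - g x‖ₑ ^ p ∂(wMeasure w)))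
    (h0 : ∀ g, Tendsto (fun i => Ψ i g) l (𝓝 0)) {ε : ℝ≥0∞} (hε : 0 < ε) :
    ∀ᶠ i in l, ∀ f ∈ K, Ψ i f ≤ ε := by
  -- `C + 1` in place of `C` keeps the denominator nonzero.
  have hδ : 0 < ε / (2 * (C + 1)) :=
    ENNReal.div_pos hε.ne' (ENNReal.mul_ne_top (by simp) (by simp [hC]))
  obtain ⟨t, ht, h⟩ := hK.exists_net hp hδ
  have h1 : ∀ᶠ i in l, ∀ g ∈ t, Ψ i g ≤ ε / (2 * (C + 1)) :=
    (eventually_all_finite ht).2 fun g _ => ENNReal.tendsto_nhds_zero.1 (h0 g) _ hδ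
  filter_upwards [hΨ, h1] with i h2 h3 f hf
  obtain ⟨g, hg, hfg⟩ := h f hf
  calc Ψ i f ≤ C * (ε / (2 * (C + 1)) + ε / (2 * (C + 1))) :=
        (h2 f g).trans (by gcongr; exact h3 g hg)
    _ ≤ (C + 1) * (2 * (ε / (2 * (C + 1)))) := by
        rw [← two_mul]
        gcongr
        exact le_self_add
    _ = (2 * (C + 1)) * (ε / (2 * (C + 1))) := by ring
    _ ≤ ε := ENNReal.mul_div_le

theorem eventually_mem_ball_zero (x : Space n₁ n₂) : ∀ᶠ A : ℝ in atTop, x ∈ ball 0 A := by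
  filter_upwards [eventually_gt_atTop (‖x.1‖ + ‖x.2‖)] with A hA
  simpa [ball] using hA

theorem IsPrecompact.uniformlySmallTails (hp : 0 < p) {K : Set (WLp 𝕜 p w)}
    (hK : IsPrecompact K) : UniformlySmallTails K := by
  refine (tendsto_iSup_wNorm_iff hp
    (fun (A : ℝ) (f : WLp 𝕜 p w) => (ball 0 A)ᶜ.indicator (f : Space n₁ n₂ → 𝕜))).2 fun ε hε => ?_
  refine hK.eventually_forall_le hp (C := 2 ^ p) (by simp) ?_ ?_ hε
  · refine Eventually.of_forall fun A f g => ?_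
    refine (lintegral_rpow_le_of_enorm_le_add hp.le
      ((Lp.aestronglyMeasurable g).indicator (measurableSet_ball 0 A).compl).enorm
      (H := fun x => ‖f x - g x‖ₑ) fun x => ?_)
    by_cases hx : x ∈ (ball (0 : Space n₁ n₂) A)ᶜ
    · simp only [indicator_of_mem hx]
      simpa using enorm_add_le (g x) (f x - g x)
    · simp [indicator_of_notMem hx]
  · intro g
    have h := tendsto_lintegral_filter_of_dominated_convergence (μ := wMeasure w)
      (l := (atTop : Filter ℝ)) (F := fun A x => ‖(ball 0 A)ᶜ.indicator (g : Space n₁ n₂ → 𝕜) x‖ₑ ^ p)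
      (f := fun _ => 0) (fun x => ‖g x‖ₑ ^ p) (Eventually.of_forall fun A =>
        (((Lp.stronglyMeasurable g).indicator (measurableSet_ball 0 A).compl).enorm).pow_const p)
      (Eventually.of_forall fun A => Eventually.of_forall fun x => ?_)
      (lintegral_rpow_lt_top hp g).ne (Eventually.of_forall fun x => ?_)
    · simpa using h
    · refine ENNReal.rpow_le_rpow ?_ hp.le
      exact enorm_indicator_le_enorm_self _ _
    · refine tendsto_const_nhds.congr' ?_
      filter_upwards [eventually_mem_ball_zero x] with A hA
      simp [hA, hp]

theorem measurable_setLIntegral_translate {f : Space n₁ n₂ → 𝕜} (hf : Measurable f) (a : ℝ)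
    (s : Set (Space n₁ n₂)) :
    Measurable fun x => ∫⁻ y in s, ‖f (x - y) - f x‖ₑ ^ a :=
  Measurable.lintegral_prod_right' (f := fun z : Space n₁ n₂ × Space n₁ n₂ =>
    ‖f (z.1 - z.2) - f z.1‖ₑ ^ a)
    (((hf.comp (by fun_prop)).sub (hf.comp measurable_fst)).enorm.pow_const a)

theorem measurable_translationMean {f : Space n₁ n₂ → 𝕜} (hf : Measurable f) (a r : ℝ) :
    Measurable (translationMean a r f) := by
  unfold translationMean
  simp only [setLAverage_eq]
  exact ((measurable_setLIntegral_translate hf a _).div_const _).pow_const _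

theorem translationMean_rpow (a r s : ℝ) (f : Space n₁ n₂ → 𝕜) (x : Space n₁ n₂) :
    translationMean a r f x ^ s =
      (⨍⁻ y in ball (0 : Space n₁ n₂) r, ‖f (x - y) - f x‖ₑ ^ a ∂volume) ^ (s / a) := by
  rw [translationMean, ← ENNReal.rpow_mul]
  congr 1
  ring

/-- Subadditivity of `t ↦ t ^ a` is where `a ≤ 1` enters: averages of `a`-th powers can then be
added without constants, even when `f` is not locally integrable. -/
theorem enorm_add_rpow_le (ha : 0 ≤ a) (ha1 : a ≤ 1) (u v : 𝕜) :
    ‖u + v‖ₑ ^ a ≤ ‖u‖ₑ ^ a + ‖v‖ₑ ^ a :=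
  (ENNReal.rpow_le_rpow (enorm_add_le u v) ha).trans (ENNReal.rpow_add_le_add_rpow _ _ ha ha1)

theorem lintegral_translationMean_rpow_le_add (hp : 0 < p) (ha : 0 < a) (ha1 : a ≤ 1)
    {f g : Space n₁ n₂ → 𝕜} (hg : Measurable g) (r : ℝ) :
    ∫⁻ x, translationMean a r f x ^ p ∂(wMeasure w) ≤ 2 ^ (p / a) *
      (∫⁻ x, translationMean a r g x ^ p ∂(wMeasure w) +
        ∫⁻ x, translationMean a r (f - g) x ^ p ∂(wMeasure w)) := by
  simp only [translationMean_rpow]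
  refine lintegral_rpow_le_of_enorm_le_add (by positivity) ?_ fun x => ?_
  · simp only [setLAverage_eq]
    exact ((measurable_setLIntegral_translate hg a _).div_const _).aemeasurable
  · simp only [setLAverage_eq]
    have hm : Measurable fun y => ‖g (x - y) - g x‖ₑ ^ a :=
      ((hg.comp (measurable_const.sub measurable_id)).sub measurable_const).enorm.pow_const a
    rw [← ENNReal.add_div, ← lintegral_add_left hm]
    gcongr with y
    refine le_trans (le_of_eq ?_) (enorm_add_rpow_le ha.le ha1 _ _)
    congr 2
    simp only [Pi.sub_apply]
    ring

/-- Translation means are bounded on `L^p(w)`, uniformly in the radius. -/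
theorem IsAp.exists_lintegral_translationMean_rpow_le (hp₀ : 1 < p₀) (hw : IsAp p₀ w)
    (hp : 0 < p) (ha : 0 < a) (ha1 : a ≤ 1) (hap : p₀ ≤ p / a) :
    ∃ C : ℝ≥0∞, C ≠ ∞ ∧ ∀ r : ℝ, 0 < r → ∀ f : Space n₁ n₂ → 𝕜, Measurable f →
      ∫⁻ x, translationMean a r f x ^ p ∂(wMeasure w) ≤
        C * ∫⁻ x, ‖f x‖ₑ ^ p ∂(wMeasure w) := by
  -- The averages act on `|f|^a`, whose `p / a`-th power is `|f|^p`; this requires `p₀ ≤ p / a`.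
  obtain ⟨C, hC, h⟩ := hw.exists_lintegral_average_rpow_le hp₀ hap
  refine ⟨2 ^ (p / a) * (1 + C), ENNReal.mul_ne_top (by simp) (by simp [hC]),
    fun r hr f hf => ?_⟩
  have hG : Measurable fun x => ‖f x‖ₑ ^ a := hf.enorm.pow_const a
  have hpow : ∀ x, (‖f x‖ₑ ^ a) ^ (p / a) = ‖f x‖ₑ ^ p := fun x => by
    rw [← ENNReal.rpow_mul, mul_div_cancel₀ _ ha.ne']
  have h1 := h r hr (fun x => ‖f x‖ₑ ^ a) hG
  simp only [hpow] at h1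
  simp only [translationMean_rpow]
  have hb0 := (volume_ball_pos (0 : Space n₁ n₂) hr).ne'
  have hbt := (volume_ball_lt_top (0 : Space n₁ n₂) r).ne
  refine (lintegral_rpow_le_of_enorm_le_add (by positivity) (G := fun x => ‖f x‖ₑ ^ a)
    (H := fun x => ⨍⁻ y in ball (0 : Space n₁ n₂) r, ‖f (x - y)‖ₑ ^ a ∂volume) hG.aemeasurable
    fun x => ?_).trans ?_
  · rw [← setLAverage_const hb0 hbt (‖f x‖ₑ ^ a)]
    simp only [setLAverage_eq]
    rw [← ENNReal.add_div, ← lintegral_add_left measurable_const]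
    gcongr with y
    rw [sub_eq_add_neg, add_comm]
    simpa using enorm_add_rpow_le ha.le ha1 (-f x) (f (x - y))
  · simp only [hpow]
    rw [mul_assoc, add_mul, one_mul]
    gcongr

/-- Uniform continuity makes the means small everywhere, and for `r < 1` they vanish outside a fixed
ball, which has finite `w`-measure. -/
theorem tendsto_lintegral_translationMean_of_hasCompactSupport
    [IsLocallyFiniteMeasure (wMeasure w)] (hp : 0 < p) (ha : 0 < a) {g : Space n₁ n₂ → 𝕜}
    (hg : Continuous g) (hgs : HasCompactSupport g) :
    Tendsto (fun r => ∫⁻ x, translationMean a r g x ^ p ∂(wMeasure w)) (𝓝[>] 0) (𝓝 0) := by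
  obtain ⟨R, hR⟩ := hgs.isCompact.isBounded.subset_ball (0 : Space n₁ n₂)
  have hg0 : ∀ x, x ∉ Metric.ball (0 : Space n₁ n₂) R → g x = 0 := fun x hx =>
    image_eq_zero_of_notMem_tsupport fun h => hx (hR h)
  set B := Metric.ball (0 : Space n₁ n₂) (R + 1) with hB
  have hBt : wMeasure w B ≠ ∞ := measure_ball_lt_top.ne
  have huc := hgs.uniformContinuous_of_continuous hg
  rw [ENNReal.tendsto_nhds_zero]
  intro ε hε
  set η := (ε / (wMeasure w B + 1)) ^ p⁻¹ with hη
  have hη0 : 0 < η := ENNReal.rpow_pos_of_nonneg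
    (ENNReal.div_pos hε.ne' (by simp [hBt])) (by positivity)
  obtain ⟨δ, hδ, hgδ⟩ := EMetric.uniformContinuous_iff.1 huc η hη0
  obtain ⟨d, hd, hdδ⟩ := ENNReal.lt_iff_exists_real_btwn.1 hδ
  have hd0 : 0 < d := by simpa using hdδ.1
  have hmem : Ioo (0 : ℝ) (min d 1) ∈ 𝓝[>] (0 : ℝ) := Ioo_mem_nhdsGT (lt_min hd0 one_pos)
  filter_upwards [hmem] with r hr
  have hrd : r < d := hr.2.trans_le (min_le_left _ _)
  have hr1 : r < 1 := hr.2.trans_le (min_le_right _ _)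
  have hyr : ∀ y ∈ ball (0 : Space n₁ n₂) r, ‖y‖ < r := fun y hy => by
    simpa using ball_subset_metricBall 0 r hy
  have hle : ∀ x, translationMean a r g x ^ p ≤ B.indicator (fun _ => η ^ p) x := by
    intro x
    by_cases hx : x ∈ B
    · rw [indicator_of_mem hx]
      refine ENNReal.rpow_le_rpow ?_ hp.le
      unfold translationMean
      rw [one_div, ENNReal.rpow_inv_le_iff ha,
        ← setLAverage_const (volume_ball_pos (0 : Space n₁ n₂) hr.1).ne'
          (volume_ball_lt_top (0 : Space n₁ n₂) r).ne (η ^ a)]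
      simp only [setLAverage_eq]
      gcongr ?_ / _
      refine setLIntegral_mono' (measurableSet_ball 0 r) fun y hy => ?_
      refine ENNReal.rpow_le_rpow ?_ ha.le
      rw [← edist_eq_enorm_sub]
      refine (hgδ ?_).le
      rw [edist_dist, dist_eq_norm, sub_sub_cancel_left, norm_neg]
      exact (ENNReal.ofReal_le_ofReal ((hyr y hy).le.trans hrd.le)).trans_lt hdδ.2
    · rw [indicator_of_notMem hx]
      have hx' : R + 1 ≤ ‖x‖ := by simpa [hB] using hx
      unfold translationMean
      have : ∫⁻ y in ball (0 : Space n₁ n₂) r, ‖g (x - y) - g x‖ₑ ^ a = 0 := by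
        rw [setLIntegral_congr_fun (g := fun _ => 0) (measurableSet_ball 0 r)]
        · simp
        · intro y hy
          have h1 : g x = 0 := hg0 x (by simp; linarith)
          have h2 : g (x - y) = 0 := hg0 _ (by
            have := norm_sub_norm_le x y
            have := hyr y hy
            simp; linarith)
          simp [h1, h2, ha]
      rw [setLAverage_eq, this]
      simp [ha, hp]
  refine (lintegral_mono hle).trans ?_
  rw [lintegral_indicator_const Metric.isOpen_ball.measurableSet, hη, ENNReal.rpow_inv_rpow hp.ne']
  calc ε / (wMeasure w B + 1) * wMeasure w B ≤ ε / (wMeasure w B + 1) * (wMeasure w B + 1) := by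
        gcongr
        exact le_self_add
    _ ≤ ε := by
      rw [mul_comm]
      exact ENNReal.mul_div_le

/-- Translation means of a function in `L^p(w)` tend to zero. -/
theorem IsAp.tendsto_lintegral_translationMean (hp₀ : 1 < p₀) (hw : IsAp p₀ w)
    (hp : 0 < p) (ha : 0 < a) (ha1 : a ≤ 1) (hap : p₀ ≤ p / a) (f : WLp 𝕜 p w) :
    Tendsto (fun r => ∫⁻ x, translationMean a r f x ^ p ∂(wMeasure w)) (𝓝[>] 0) (𝓝 0) := by
  have := hw.isLocallyFiniteMeasure hp₀
  obtain ⟨C, hC, h⟩ := hw.exists_lintegral_translationMean_rpow_le (𝕜 := 𝕜) hp₀ hp ha ha1 hap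
  rw [ENNReal.tendsto_nhds_zero]
  intro ε hε
  set D : ℝ≥0∞ := 2 ^ (p / a) * (C + 1) with hD
  have hDt : D ≠ ∞ := ENNReal.mul_ne_top (by simp) (by simp [hC])
  have hδ : 0 < ε / (2 * D) := ENNReal.div_pos hε.ne' (ENNReal.mul_ne_top (by simp) hDt)
  -- Approximation by compactly supported continuous functions holds for every finite `p > 0`, since
  -- `w dx` is locally finite.
  obtain ⟨g, hgs, hfg, hgc, -⟩ := (Lp.memLp f).exists_hasCompactSupport_eLpNorm_sub_le
    ENNReal.ofReal_ne_top (ε := (ε / (2 * D)) ^ p⁻¹)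
    (ENNReal.rpow_pos_of_nonneg hδ (by positivity)).ne'
  have hfg' := (wNorm_le_iff hp w _ _).1 hfg
  rw [ENNReal.rpow_inv_rpow hp.ne'] at hfg'
  filter_upwards [ENNReal.tendsto_nhds_zero.1
    (tendsto_lintegral_translationMean_of_hasCompactSupport (w := w) hp ha hgc hgs) _ hδ,
    self_mem_nhdsWithin] with r hr hr0
  have hfm : Measurable f := (Lp.stronglyMeasurable f).measurable
  calc ∫⁻ x, translationMean a r f x ^ p ∂(wMeasure w)
      ≤ 2 ^ (p / a) * (∫⁻ x, translationMean a r g x ^ p ∂(wMeasure w) +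
        ∫⁻ x, translationMean a r (⇑f - g) x ^ p ∂(wMeasure w)) :=
        lintegral_translationMean_rpow_le_add hp ha ha1 hgc.measurable r
    _ ≤ 2 ^ (p / a) * (ε / (2 * D) + C * (ε / (2 * D))) := by
        gcongr
        exact (h r hr0 _ (hfm.sub hgc.measurable)).trans (by gcongr)
    _ = D * (ε / (2 * D)) := by rw [hD]; ring
    _ ≤ (2 * D) * (ε / (2 * D)) := by
        gcongr
        rw [two_mul]
        exact le_self_add
    _ ≤ ε := ENNReal.mul_div_le

/-- Translation means tend to zero uniformly on precompact sets. -/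
theorem IsPrecompact.eventually_translationMean_le (hp₀ : 1 < p₀) (hw : IsAp p₀ w)
    (hp : 0 < p) (ha : 0 < a) (ha1 : a ≤ 1) (hap : p₀ ≤ p / a) {K : Set (WLp 𝕜 p w)}
    (hK : IsPrecompact K) {ε : ℝ≥0∞} (hε : 0 < ε) :
    ∀ᶠ r in 𝓝[>] (0 : ℝ), ∀ f ∈ K, ∫⁻ x, translationMean a r f x ^ p ∂(wMeasure w) ≤ ε := by
  obtain ⟨C, hC, h⟩ := hw.exists_lintegral_translationMean_rpow_le (𝕜 := 𝕜) hp₀ hp ha ha1 hap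
  refine hK.eventually_forall_le hp (C := 2 ^ (p / a) * (C + 1))
    (ENNReal.mul_ne_top (by simp) (by simp [hC])) ?_
    (fun g => hw.tendsto_lintegral_translationMean hp₀ hp ha ha1 hap g) hε
  filter_upwards [self_mem_nhdsWithin] with r hr f g
  have hfm : Measurable f := (Lp.stronglyMeasurable f).measurable
  have hgm : Measurable g := (Lp.stronglyMeasurable g).measurable
  refine (lintegral_translationMean_rpow_le_add hp ha ha1 hgm r).trans ?_
  rw [mul_assoc]
  gcongr
  refine (add_le_add_right (h r hr _ (hfm.sub hgm)) _).trans ?_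
  rw [mul_add]
  gcongr
  · exact le_mul_of_one_le_left zero_le le_add_self
  · exact le_self_add
  · exact le_rfl

/-- Hölder against the locally integrable dual weight. It ensures that the averages in (c') are true
integrals and not the default value `0`. -/
theorem IsAp.integrableOn_of_isBounded (hp : 1 < p) (hw : IsAp p w) (f : WLp 𝕜 p w)
    {E : Set (Space n₁ n₂)} (hE : MeasurableSet E) (hEb : Bornology.IsBounded E) :
    IntegrableOn f E volume := by
  have hp0 : 0 < p := by linarith
  refine ⟨(Lp.stronglyMeasurable f).aestronglyMeasurable, ?_⟩
  have h := hw.1.lintegral_rpow_le hp hE (Lp.stronglyMeasurable f).enorm.aemeasurable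
  obtain ⟨R, hR⟩ := hEb.subset_ball (0 : Space n₁ n₂)
  refine (ENNReal.rpow_lt_top_iff_of_pos hp0).1 (h.trans_lt (ENNReal.mul_lt_top ?_ ?_))
  · exact (setLIntegral_le_lintegral _ _).trans_lt (lintegral_rpow_lt_top hp0 f)
  · exact ENNReal.rpow_lt_top_of_nonneg (by linarith)
      ((lintegral_mono_set hR).trans_lt (hw.lintegral_dual_metricBall_lt_top hp 0 R)).ne

theorem isBounded_ball (x : Space n₁ n₂) (r : ℝ) : Bornology.IsBounded (ball x r) :=
  Metric.isBounded_ball.subset (ball_subset_metricBall x r)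

/-- The difference is the average of `f x - f y` over the ball. Hence the bounds for translation
means with `a = 1` give (c'). -/
theorem enorm_sub_average_le_translationMean {f : Space n₁ n₂ → 𝕜} {x : Space n₁ n₂} (hr : 0 < r)
    (hf : IntegrableOn f (ball x r) volume) :
    ‖f x - ⨍ y in ball x r, f y ∂volume‖ₑ ≤ translationMean 1 r f x := by
  have hb0 := (volume_ball_pos x hr).ne'
  have hbt := (volume_ball_lt_top x r).ne
  have : IsFiniteMeasure (volume.restrict (ball x r)) := ⟨by simpa using hbt.lt_top⟩
  have h1 : f x - ⨍ y in ball x r, f y ∂volume = ⨍ y in ball x r, (f x - f y) ∂volume := by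
    nth_rw 1 [← setAverage_const hb0 hbt (f x)]
    simp only [setAverage_eq]
    rw [integral_sub (integrable_const _) hf, smul_sub]
  rw [h1]
  unfold translationMean
  simp only [ENNReal.rpow_one, div_one, setLAverage_eq, setAverage_eq]
  rw [setLIntegral_ball_zero_comp_sub x r (fun z => ‖f z - f x‖ₑ), enorm_smul, div_eq_mul_inv,
    mul_comm, ← volume_ball x]
  gcongr
  · refine (enorm_integral_le_lintegral_enorm _).trans (le_of_eq ?_)
    simp only [enorm_sub_rev]
  · rw [Measure.real, ← ENNReal.toReal_inv, Real.enorm_eq_ofReal ENNReal.toReal_nonneg,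
      ENNReal.ofReal_toReal (by simp [hb0])]

end Necessity

end BiParam

namespace BiParam

/-! ### Sufficiency: step functions on grids -/

section Sufficiency

variable {𝕜 : Type*} [RCLike 𝕜] {n₁ n₂ : ℕ} {p p₀ a r δ : ℝ} {w : Space n₁ n₂ → ℝ≥0∞}

/-- The index of the cell of the grid of mesh `δ` that contains `x`. -/
noncomputable def gridIndex (δ : ℝ) (x : Space n₁ n₂) : (Fin n₁ → ℤ) × (Fin n₂ → ℤ) :=
  (fun i => ⌊x.1 i / δ⌋, fun i => ⌊x.2 i / δ⌋)

theorem measurable_gridIndex (δ : ℝ) :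
    Measurable (gridIndex δ : Space n₁ n₂ → (Fin n₁ → ℤ) × (Fin n₂ → ℤ)) := by
  refine Measurable.prodMk (measurable_pi_lambda _ fun i => ?_) (measurable_pi_lambda _ fun i => ?_)
  · exact Measurable.floor (by fun_prop)
  · exact Measurable.floor (by fun_prop)

theorem abs_sub_lt_of_floor_div_eq (hδ : 0 < δ) {s t : ℝ} (h : ⌊s / δ⌋ = ⌊t / δ⌋) :
    |s - t| < δ := by
  have := Int.abs_sub_lt_one_of_floor_eq_floor h
  rwa [← sub_div, abs_div, abs_of_pos hδ, div_lt_one hδ] at this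

theorem dist_lt_of_gridIndex_eq (hδ : 0 < δ) {x y : Space n₁ n₂}
    (h : gridIndex δ x = gridIndex δ y) : dist x y < δ := by
  rw [Prod.dist_eq, max_lt_iff, dist_pi_lt_iff hδ, dist_pi_lt_iff hδ]
  have h1 := (Prod.ext_iff.1 h).1
  have h2 := (Prod.ext_iff.1 h).2
  exact ⟨fun i => abs_sub_lt_of_floor_div_eq hδ (congrFun h1 i),
    fun i => abs_sub_lt_of_floor_div_eq hδ (congrFun h2 i)⟩

/-- The centre of the cell with index `k`. -/
noncomputable def gridCenter (δ : ℝ) (k : (Fin n₁ → ℤ) × (Fin n₂ → ℤ)) : Space n₁ n₂ :=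
  (fun i => δ * (k.1 i + 1 / 2), fun i => δ * (k.2 i + 1 / 2))

theorem floor_div_eq_of_abs_sub_lt (hδ : 0 < δ) {s : ℝ} {m : ℤ}
    (h : |s - δ * (m + 1 / 2)| < δ / 2) : ⌊s / δ⌋ = m := by
  rw [abs_lt] at h
  rw [Int.floor_eq_iff, le_div_iff₀ hδ, div_lt_iff₀ hδ]
  constructor <;> nlinarith [h.1, h.2]

theorem metricBall_gridCenter_subset (hδ : 0 < δ) (k : (Fin n₁ → ℤ) × (Fin n₂ → ℤ)) :
    Metric.ball (gridCenter δ k) (δ / 2) ⊆ gridIndex δ ⁻¹' {k} := by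
  intro x hx
  rw [Metric.mem_ball, Prod.dist_eq, max_lt_iff, dist_pi_lt_iff (half_pos hδ),
    dist_pi_lt_iff (half_pos hδ)] at hx
  refine Prod.ext (funext fun i => ?_) (funext fun i => ?_)
  · exact floor_div_eq_of_abs_sub_lt hδ (hx.1 i)
  · exact floor_div_eq_of_abs_sub_lt hδ (hx.2 i)

theorem gridIndex_gridCenter (hδ : 0 < δ) (k : (Fin n₁ → ℤ) × (Fin n₂ → ℤ)) :
    gridIndex δ (gridCenter δ k) = k :=
  metricBall_gridCenter_subset hδ k (Metric.mem_ball_self (half_pos hδ))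

theorem finite_gridIndex_image_ball (hδ : 0 < δ) (A : ℝ) :
    (gridIndex δ '' ball (0 : Space n₁ n₂) A).Finite := by
  have hb : ∀ s : ℝ, |s| < A → ⌊s / δ⌋ ∈ Icc ⌊-A / δ⌋ ⌊A / δ⌋ := fun s hs => by
    rw [abs_lt] at hs
    exact ⟨Int.floor_le_floor (by gcongr; exact hs.1.le), Int.floor_le_floor (by gcongr; exact hs.2.le)⟩
  refine Set.Finite.subset (Set.Finite.prod (Set.Finite.pi' fun _ : Fin n₁ => finite_Icc ⌊-A / δ⌋ ⌊A / δ⌋)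
    (Set.Finite.pi' fun _ : Fin n₂ => finite_Icc ⌊-A / δ⌋ ⌊A / δ⌋)) ?_
  rintro _ ⟨x, hx, rfl⟩
  have hx' : ‖x‖ < A := by simpa using ball_subset_metricBall 0 A hx
  exact ⟨fun i => hb _ (((norm_le_pi_norm x.1 i).trans (norm_fst_le x)).trans_lt hx'),
    fun i => hb _ (((norm_le_pi_norm x.2 i).trans (norm_snd_le x)).trans_lt hx')⟩

theorem preimage_gridIndex_image_ball_subset (hδ : 0 < δ) (A : ℝ) :
    gridIndex δ ⁻¹' (gridIndex δ '' ball (0 : Space n₁ n₂) A) ⊆ Metric.ball 0 (A + δ) := by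
  rintro x ⟨y, hy, hxy⟩
  have h1 := ball_subset_metricBall 0 A hy
  have h2 := dist_lt_of_gridIndex_eq hδ hxy
  rw [Metric.mem_ball] at h1 ⊢
  linarith [dist_triangle x y 0, dist_comm x y]

theorem measurableSet_gridIndex_preimage (δ : ℝ) (S : Set ((Fin n₁ → ℤ) × (Fin n₂ → ℤ))) :
    MeasurableSet (gridIndex δ ⁻¹' S : Set (Space n₁ n₂)) :=
  measurable_gridIndex δ (Set.to_countable S).measurableSet

theorem lintegral_eq_tsum_gridIndex (δ : ℝ) (μ : Measure (Space n₁ n₂)) (F : Space n₁ n₂ → ℝ≥0∞) :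
    ∫⁻ x, F x ∂μ = ∑' k, ∫⁻ x in gridIndex δ ⁻¹' {k}, F x ∂μ := by
  rw [← lintegral_iUnion (fun k => measurableSet_gridIndex_preimage δ {k})]
  · rw [← preimage_iUnion, iUnion_of_singleton, preimage_univ, Measure.restrict_univ]
  · intro i j hij
    exact Disjoint.preimage _ (disjoint_singleton.2 hij)

theorem wMeasure_cell_pos (hw : IsWeight w) (hδ : 0 < δ) (k : (Fin n₁ → ℤ) × (Fin n₂ → ℤ)) :
    0 < wMeasure w (gridIndex δ ⁻¹' {k}) :=
  (hw.wMeasure_metricBall_pos _ (half_pos hδ)).trans_le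
    (measure_mono (metricBall_gridCenter_subset hδ k))

theorem cell_subset_metricBall (hδ : 0 < δ) {k : (Fin n₁ → ℤ) × (Fin n₂ → ℤ)} {x : Space n₁ n₂}
    (hx : gridIndex δ x = k) : gridIndex δ ⁻¹' {k} ⊆ Metric.ball x δ := fun _ hy =>
  dist_lt_of_gridIndex_eq hδ (Eq.trans hy hx.symm)

theorem wMeasure_cell_lt_top [IsLocallyFiniteMeasure (wMeasure w)] (hδ : 0 < δ)
    (k : (Fin n₁ → ℤ) × (Fin n₂ → ℤ)) : wMeasure w (gridIndex δ ⁻¹' {k}) < ∞ :=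
  (measure_mono (cell_subset_metricBall hδ (gridIndex_gridCenter hδ k))).trans_lt
    measure_ball_lt_top

/-- A bounded set with uniformly small tails whose members are uniformly approximated by step
functions on grids is precompact. -/
theorem isPrecompact_of_step_approximation (hp : 0 < p) (hw : IsWeight w)
    [IsLocallyFiniteMeasure (wMeasure w)] {K : Set (WLp 𝕜 p w)} (hb : UniformlyBounded K)
    (ht : UniformlySmallTails K)
    (H : ∀ ε : ℝ≥0∞, 0 < ε → ∀ A : ℝ, 0 < A → ∃ δ : ℝ, 0 < δ ∧ ∀ f ∈ K,
      ∃ c : (Fin n₁ → ℤ) × (Fin n₂ → ℤ) → 𝕜,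
        ∫⁻ x in gridIndex δ ⁻¹' (gridIndex δ '' ball 0 A), ‖f x - c (gridIndex δ x)‖ₑ ^ p
          ∂(wMeasure w) ≤ ε) :
    IsPrecompact K := by
  rw [isPrecompact_iff hp]
  intro ε hε
  have h2p : (2 : ℝ≥0∞) ^ p ≠ ∞ := by simp
  have hεp : 0 < ε ^ p := ENNReal.rpow_pos_of_nonneg hε hp.le
  -- The denominator accounts for the tail and, with factor `2 ^ p`, for two errors on the bounded
  -- region. The cap `1` keeps `e` finite when `ε = ∞`.
  set e : ℝ≥0∞ := min (ε ^ p / (1 + 2 * 2 ^ p)) 1 with he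
  have he0 : 0 < e := lt_min (ENNReal.div_pos hεp.ne' (by finiteness)) one_pos
  have het : e ≠ ∞ := ((min_le_right _ _).trans_lt ENNReal.one_lt_top).ne
  have heε : e + 2 ^ p * (e + e) ≤ ε ^ p :=
    calc e + 2 ^ p * (e + e) = (1 + 2 * 2 ^ p) * e := by ring
      _ ≤ (1 + 2 * 2 ^ p) * (ε ^ p / (1 + 2 * 2 ^ p)) := by gcongr; exact min_le_left _ _
      _ ≤ ε ^ p := ENNReal.mul_div_le
  obtain ⟨A, hA, hA0⟩ := (((tendsto_iSup_wNorm_iff hp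
    (fun (A : ℝ) (f : WLp 𝕜 p w) => (ball 0 A)ᶜ.indicator (f : Space n₁ n₂ → 𝕜))).1 ht e he0).and
      (eventually_gt_atTop 0)).exists
  obtain ⟨δ, hδ, hK⟩ := H e he0 A hA0
  set S := gridIndex δ '' ball (0 : Space n₁ n₂) A with hS
  set U : Set (Space n₁ n₂) := gridIndex δ ⁻¹' S with hU
  have hSf : S.Finite := finite_gridIndex_image_ball hδ A
  have hUm : MeasurableSet U := measurableSet_gridIndex_preimage δ S
  have hUt : wMeasure w U ≠ ∞ :=
    ((measure_mono (preimage_gridIndex_image_ball_subset hδ A)).trans_lt measure_ball_lt_top).ne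
  have hAU : ball 0 A ⊆ U := subset_preimage_image _ _
  have : Fintype S := hSf.fintype
  choose! c hc using hK
  set M : ℝ≥0∞ := (⨆ f ∈ K, wNorm p w (f : Space n₁ n₂ → 𝕜)) ^ p with hM
  have hMt : M ≠ ∞ := ENNReal.rpow_ne_top_of_nonneg hp.le hb.ne
  have hfM : ∀ f ∈ K, ∫⁻ x, ‖f x‖ₑ ^ p ∂(wMeasure w) ≤ M := fun f hf => by
    rw [← wNorm_rpow hp]
    exact ENNReal.rpow_le_rpow (le_iSup₂ (f := fun (f : WLp 𝕜 p w) (_ : f ∈ K) =>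
      wNorm p w (f : Space n₁ n₂ → 𝕜)) f hf) hp.le
  -- The step function is bounded in `L^p(w)` because `f` is and it is close to `f`; each cell has
  -- positive weight, so each single coefficient is bounded.
  have hcb : ∀ f ∈ K, ∀ k ∈ S, ‖c f k‖ₑ ^ p ≤
      2 ^ p * (M + e) / wMeasure w (gridIndex δ ⁻¹' {k}) := fun f hf k hk => by
    rw [ENNReal.le_div_iff_mul_le (Or.inl (wMeasure_cell_pos hw hδ k).ne')
      (Or.inl (wMeasure_cell_lt_top hδ k).ne), ← setLIntegral_const]
    calc ∫⁻ x in gridIndex δ ⁻¹' {k}, ‖c f k‖ₑ ^ p ∂(wMeasure w)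
        = ∫⁻ x in gridIndex δ ⁻¹' {k}, ‖c f (gridIndex δ x)‖ₑ ^ p ∂(wMeasure w) :=
          setLIntegral_congr_fun (measurableSet_gridIndex_preimage δ {k}) fun x hx => by
            rw [show gridIndex δ x = k from hx]
      _ ≤ ∫⁻ x in U, ‖c f (gridIndex δ x)‖ₑ ^ p ∂(wMeasure w) :=
          lintegral_mono_set (preimage_mono (singleton_subset_iff.2 hk))
      _ ≤ 2 ^ p * (∫⁻ x in U, ‖f x‖ₑ ^ p ∂(wMeasure w) +
            ∫⁻ x in U, ‖f x - c f (gridIndex δ x)‖ₑ ^ p ∂(wMeasure w)) := by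
          refine lintegral_rpow_le_of_enorm_le_add hp.le (Lp.aestronglyMeasurable f).enorm.restrict
            fun x => ?_
          rw [← enorm_neg (f x - _), neg_sub]
          refine le_trans (le_of_eq ?_) (enorm_add_le _ _)
          rw [add_sub_cancel]
      _ ≤ 2 ^ p * (M + e) := by
          gcongr
          · exact (setLIntegral_le_lintegral _ _).trans (hfM f hf)
          · exact hc f hf
  set R : ℝ≥0∞ := ∑ k : S, (2 ^ p * (M + e) / wMeasure w (gridIndex δ ⁻¹' {k.1})) ^ p⁻¹ with hR
  have hRt : R ≠ ∞ := ENNReal.sum_ne_top.2 fun k _ => ENNReal.rpow_ne_top_of_nonneg (by positivity)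
    (ENNReal.div_ne_top (by finiteness) (wMeasure_cell_pos hw hδ k.1).ne')
  have hcR : ∀ f ∈ K, (fun k : S => c f k) ∈ Metric.closedBall (0 : S → 𝕜) R.toReal :=
    fun f hf => by
      rw [mem_closedBall_zero_iff, pi_norm_le_iff_of_nonneg ENNReal.toReal_nonneg]
      intro k
      have h1 : ‖c f k‖ₑ ≤ R := by
        have h2 := hcb f hf k k.2
        rw [← ENNReal.le_rpow_inv_iff hp] at h2
        exact h2.trans (Finset.single_le_sum (f := fun k : S =>
          (2 ^ p * (M + e) / wMeasure w (gridIndex δ ⁻¹' {k.1})) ^ p⁻¹)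
          (fun _ _ => zero_le) (Finset.mem_univ k))
      simpa using ENNReal.toReal_mono hRt h1
  obtain ⟨η, hη0, hη⟩ : ∃ η : ℝ, 0 < η ∧ ENNReal.ofReal η ^ p * wMeasure w U ≤ e := by
    have h1 : 0 < (e / (wMeasure w U + 1)) ^ p⁻¹ := ENNReal.rpow_pos_of_nonneg
      (ENNReal.div_pos he0.ne' (by simp [hUt])) (by positivity)
    obtain ⟨η, -, hη0, hη⟩ := ENNReal.lt_iff_exists_real_btwn.1 h1
    refine ⟨η, by simpa using hη0, ?_⟩
    have h2 := (ENNReal.le_rpow_inv_iff hp).1 hη.le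
    calc ENNReal.ofReal η ^ p * wMeasure w U
        ≤ e / (wMeasure w U + 1) * (wMeasure w U + 1) := by
          gcongr
          exact le_self_add
      _ ≤ e := by
          rw [mul_comm]
          exact ENNReal.mul_div_le
  -- A bounded set of coefficient vectors in the finite-dimensional `𝕜^S` has a finite `η`-net; this
  -- net produces the one in `L^p(w)`.
  obtain ⟨T, -, hTf, hT⟩ := (isCompact_closedBall (0 : S → 𝕜) R.toReal).finite_cover_balls hη0
  classical
  let step : (S → 𝕜) → Space n₁ n₂ → 𝕜 := fun d x =>
    if h : gridIndex δ x ∈ S then d ⟨gridIndex δ x, h⟩ else 0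
  have hstepm : ∀ d, Measurable (step d) := fun d =>
    (Measurable.of_discrete (f := fun k : (Fin n₁ → ℤ) × (Fin n₂ → ℤ) =>
      if h : k ∈ S then d ⟨k, h⟩ else 0)).comp (measurable_gridIndex δ)
  have hstepLp : ∀ d, MemLp (step d) (ENNReal.ofReal p) (wMeasure w) := fun d => by
    refine ⟨(hstepm d).aestronglyMeasurable, ?_⟩
    have h1 : ∫⁻ x, ‖step d x‖ₑ ^ p ∂(wMeasure w) ≤ ‖d‖ₑ ^ p * wMeasure w U := by
      rw [← lintegral_indicator_const hUm]
      refine lintegral_mono fun x => ?_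
      by_cases hx : x ∈ U
      · rw [indicator_of_mem hx]
        simp only [step, dif_pos (show gridIndex δ x ∈ S from hx)]
        gcongr
        exact enorm_le_iff_norm_le.2 (norm_le_pi_norm d _)
      · simp [step, dif_neg (show gridIndex δ x ∉ S from hx), hp]
    rw [← ENNReal.rpow_lt_top_iff_of_pos hp, eLpNorm_rpow_eq_lintegral hp]
    exact h1.trans_lt (ENNReal.mul_lt_top (ENNReal.rpow_lt_top_of_nonneg hp.le enorm_ne_top)
      hUt.lt_top)
  refine ⟨(fun d => (hstepLp d).toLp (step d)) '' T, hTf.image _, fun f hf => ?_⟩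
  obtain ⟨d, hdT, hd⟩ := mem_iUnion₂.1 (hT (hcR f hf))
  refine ⟨_, mem_image_of_mem _ hdT, ?_⟩
  have hcd : ∀ k : S, ‖c f k - d k‖ₑ ≤ ENNReal.ofReal η := fun k => by
    rw [← ofReal_norm]
    refine ENNReal.ofReal_le_ofReal ?_
    rw [← dist_eq_norm]
    exact (dist_le_pi_dist (fun k : S => c f k) d k).trans (Metric.mem_ball.1 hd).le
  have hcongr : wNorm p w (⇑f - ⇑((hstepLp d).toLp (step d))) = wNorm p w (⇑f - step d) :=
    eLpNorm_congr_ae (EventuallyEq.rfl.sub (hstepLp d).coeFn_toLp)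
  rw [hcongr, wNorm_le_iff hp]
  refine le_trans ?_ heε
  -- Off `U` the step function is zero and only the tail of `f` remains, since `ball 0 A ⊆ U`.
  rw [← lintegral_add_compl _ hUm, add_comm]
  refine add_le_add ?_ ?_
  · refine le_trans ?_ (hA f hf)
    rw [← lintegral_indicator hUm.compl]
    refine lintegral_mono fun x => ?_
    by_cases hx : x ∈ U
    · simp [hx]
    · rw [indicator_of_mem (show x ∈ Uᶜ from hx),
        indicator_of_mem (show x ∈ (ball 0 A)ᶜ from fun h => hx (hAU h))]
      simp [step, dif_neg (show gridIndex δ x ∉ S from hx)]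
  · calc ∫⁻ x in U, ‖(⇑f - step d) x‖ₑ ^ p ∂(wMeasure w)
        = ∫⁻ x in U, ‖f x - step d x‖ₑ ^ p ∂(wMeasure w) := rfl
      _ ≤ ∫⁻ x in U, (ENNReal.ofReal η + ‖f x - c f (gridIndex δ x)‖ₑ) ^ p ∂(wMeasure w) := by
          refine setLIntegral_mono' hUm fun x hx => ?_
          refine ENNReal.rpow_le_rpow ?_ hp.le
          simp only [step, dif_pos (show gridIndex δ x ∈ S from hx)]
          rw [add_comm]
          refine le_trans ?_ (add_le_add_right (hcd ⟨_, hx⟩) _)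
          refine le_trans (le_of_eq ?_) (enorm_add_le _ _)
          rw [sub_add_sub_cancel]
      _ ≤ 2 ^ p * (∫⁻ x in U, ENNReal.ofReal η ^ p ∂(wMeasure w) +
            ∫⁻ x in U, ‖f x - c f (gridIndex δ x)‖ₑ ^ p ∂(wMeasure w)) :=
          lintegral_rpow_le_of_enorm_le_add hp.le aemeasurable_const fun x => le_rfl
      _ ≤ 2 ^ p * (e + e) := by
          rw [setLIntegral_const]
          gcongr
          exact hc f hf

/-- Functions are approximated by step functions on grids with an error controlled by their
translation means. -/
theorem exists_step_approximation (hp : 0 < p) (ha : 0 < a) (ha1 : a ≤ 1) (hw : IsWeight w)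
    [IsLocallyFiniteMeasure (wMeasure w)] :
    ∃ C : ℝ≥0∞, C ≠ ∞ ∧ ∀ r : ℝ, 0 < r → ∀ f : Space n₁ n₂ → 𝕜, Measurable f →
      ∃ c : (Fin n₁ → ℤ) × (Fin n₂ → ℤ) → 𝕜,
        ∫⁻ x, ‖f x - c (gridIndex (r / 2) x)‖ₑ ^ p ∂(wMeasure w) ≤
          C * ∫⁻ x, translationMean a r f x ^ p ∂(wMeasure w) := by
  set N := Module.finrank ℝ (Space n₁ n₂)
  set D : ℝ≥0∞ := ENNReal.ofReal (4 ^ N) ^ (p / a) * 2 ^ (p / a) with hD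
  have hpa : 0 < p / a := by positivity
  have hDt : D ≠ ∞ := ENNReal.mul_ne_top
    (ENNReal.rpow_ne_top_of_nonneg hpa.le ENNReal.ofReal_ne_top)
    (ENNReal.rpow_ne_top_of_nonneg hpa.le (by simp))
  refine ⟨D * 2, ENNReal.mul_ne_top hDt (by simp), fun r hr f hf => ?_⟩
  have hδ : 0 < r / 2 := half_pos hr
  set T := translationMean a r f with hT
  have hTm : Measurable T := measurable_translationMean hf a r
  -- A point where `T ^ p` does not exceed its `w`-average over the cell. A value of `f` is used
  -- because for `a < 1` the averages of `f` need not exist.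
  have hx0 : ∀ k, ∃ x₀ ∈ (gridIndex (r / 2) ⁻¹' {k} : Set (Space n₁ n₂)),
      T x₀ ^ p ≤ ⨍⁻ x in gridIndex (r / 2) ⁻¹' {k}, T x ^ p ∂(wMeasure w) := fun k =>
    exists_le_setLAverage (wMeasure_cell_pos hw hδ k).ne' (wMeasure_cell_lt_top hδ k).ne
      (hTm.pow_const p).aemeasurable
  choose x₀ hx₀ hTx₀ using hx0
  refine ⟨fun k => f (x₀ k), ?_⟩
  rw [lintegral_eq_tsum_gridIndex (r / 2), lintegral_eq_tsum_gridIndex (r / 2), ← ENNReal.tsum_mul_left]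
  refine ENNReal.tsum_le_tsum fun k => ?_
  set Q : Set (Space n₁ n₂) := gridIndex (r / 2) ⁻¹' {k} with hQ
  have hQm : MeasurableSet Q := measurableSet_gridIndex_preimage _ _
  -- With mesh `r / 2` the cell lies within sup-distance `r / 2` of each of its points, and the
  -- distance defining `ball` is at most twice the sup-distance.
  have hQball : ∀ x ∈ Q, Q ⊆ ball x r := fun x hx =>
    (cell_subset_metricBall hδ hx).trans (metricBall_subset_ball x r)
  have hQpos : 0 < volume Q := (Metric.measure_ball_pos volume (gridCenter (r / 2) k)
    (half_pos hδ)).trans_le (measure_mono (metricBall_gridCenter_subset hδ k))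
  have hQt : volume Q ≠ ∞ :=
    ((measure_mono (hQball _ (hx₀ k))).trans_lt (volume_ball_lt_top _ _)).ne
  have hvol : volume (ball (0 : Space n₁ n₂) r) ≤ ENNReal.ofReal (4 ^ N) * volume Q := by
    have h1 := Measure.addHaar_ball_mul_of_pos volume (0 : Space n₁ n₂)
      (show (0 : ℝ) < 4 by norm_num) (r / 2 / 2)
    rw [show 4 * (r / 2 / 2) = r by ring] at h1
    refine (measure_mono (ball_subset_metricBall 0 r)).trans (h1.trans_le ?_)
    refine mul_le_mul_right ?_ _
    rw [← Measure.addHaar_ball_center volume (gridCenter (r / 2) k)]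
    exact measure_mono (metricBall_gridCenter_subset hδ k)
  have havg : ∀ x ∈ Q, ⨍⁻ z in Q, ‖f z - f x‖ₑ ^ a ∂volume ≤ ENNReal.ofReal (4 ^ N) * T x ^ a := by
    intro x hx
    rw [hT, translationMean_rpow, div_self ha.ne', ENNReal.rpow_one, setLAverage_eq, setLAverage_eq,
      setLIntegral_ball_zero_comp_sub x r (fun z => ‖f z - f x‖ₑ ^ a)]
    have h1 : ∫⁻ z in Q, ‖f z - f x‖ₑ ^ a ≤ ∫⁻ z in ball x r, ‖f z - f x‖ₑ ^ a :=
      lintegral_mono_set (hQball x hx)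
    rw [ENNReal.div_le_iff hQpos.ne' hQt]
    refine h1.trans ?_
    have hb0 := (volume_ball_pos (0 : Space n₁ n₂) hr).ne'
    have hbt := (volume_ball_lt_top (0 : Space n₁ n₂) r).ne
    set J := ∫⁻ z in ball x r, ‖f z - f x‖ₑ ^ a
    calc J = volume (ball (0 : Space n₁ n₂) r) * (J / volume (ball (0 : Space n₁ n₂) r)) :=
          (ENNReal.mul_div_cancel hb0 hbt).symm
      _ ≤ (ENNReal.ofReal (4 ^ N) * volume Q) * (J / volume (ball (0 : Space n₁ n₂) r)) := by
          gcongr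
      _ = _ := by ring
  have hpt : ∀ x ∈ Q, ‖f x - f (x₀ k)‖ₑ ^ p ≤ D * (T x ^ p + T (x₀ k) ^ p) := by
    intro x hx
    -- Insert `f z` and average over `z` in the cell; both terms are then controlled by translation
    -- means at points of the cell.
    have h1 : ‖f x - f (x₀ k)‖ₑ ^ a ≤
        ⨍⁻ z in Q, ‖f z - f x‖ₑ ^ a ∂volume + ⨍⁻ z in Q, ‖f z - f (x₀ k)‖ₑ ^ a ∂volume := by
      rw [← setLAverage_const hQpos.ne' hQt (‖f x - f (x₀ k)‖ₑ ^ a)]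
      simp only [setLAverage_eq]
      rw [← ENNReal.add_div, ← lintegral_add_left ((hf.sub_const _).enorm.pow_const a)]
      gcongr with z
      rw [enorm_sub_rev (f z) (f x)]
      refine le_trans (le_of_eq ?_) (enorm_add_rpow_le ha.le ha1 _ _)
      rw [sub_add_sub_cancel]
    have hpow : ∀ s : ℝ≥0∞, (s ^ a) ^ (p / a) = s ^ p := fun s => by
      rw [← ENNReal.rpow_mul, mul_div_cancel₀ _ ha.ne']
    have h2 : ‖f x - f (x₀ k)‖ₑ ^ a ≤ ENNReal.ofReal (4 ^ N) * (T x ^ a + T (x₀ k) ^ a) := by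
      rw [mul_add]
      exact h1.trans (add_le_add (havg x hx) (havg _ (hx₀ k)))
    have h3 := ENNReal.rpow_le_rpow h2 hpa.le
    rw [hpow, ENNReal.mul_rpow_of_nonneg _ _ hpa.le] at h3
    refine h3.trans ?_
    rw [hD, mul_assoc]
    gcongr
    simpa only [hpow] using add_rpow_le_two_rpow_mul (T x ^ a) (T (x₀ k) ^ a) hpa.le
  calc ∫⁻ x in Q, ‖f x - f (x₀ (gridIndex (r / 2) x))‖ₑ ^ p ∂(wMeasure w)
      ≤ ∫⁻ x in Q, D * (T x ^ p + T (x₀ k) ^ p) ∂(wMeasure w) := by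
        refine setLIntegral_mono' hQm fun x hx => ?_
        rw [show gridIndex (r / 2) x = k from hx]
        exact hpt x hx
    _ = D * (∫⁻ x in Q, T x ^ p ∂(wMeasure w) + T (x₀ k) ^ p * wMeasure w Q) := by
        rw [lintegral_const_mul' _ _ hDt, lintegral_add_left (hTm.pow_const p), setLIntegral_const]
    _ ≤ D * (∫⁻ x in Q, T x ^ p ∂(wMeasure w) + ∫⁻ x in Q, T x ^ p ∂(wMeasure w)) := by
        gcongr
        refine (mul_le_mul_left (hTx₀ k) _).trans ?_
        rw [setLAverage_eq, mul_comm]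
        exact ENNReal.mul_div_le
    _ = D * 2 * ∫⁻ x in Q, T x ^ p ∂(wMeasure w) := by ring

/-- For each `ε`, one sufficiently small radius yields the grid. In this direction `A_{p₀}` serves
only to make `w dx` locally finite. -/
theorem isPrecompact_of_translationMean (hp₀ : 1 < p₀) (hw : IsAp p₀ w) (hp : 0 < p) (ha : 0 < a)
    (ha1 : a ≤ 1) {K : Set (WLp 𝕜 p w)} (hb : UniformlyBounded K) (ht : UniformlySmallTails K)
    (hc : ∀ ε : ℝ≥0∞, 0 < ε → ∀ᶠ r in 𝓝[>] (0 : ℝ), ∀ f ∈ K,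
      ∫⁻ x, translationMean a r f x ^ p ∂(wMeasure w) ≤ ε) :
    IsPrecompact K := by
  have := hw.isLocallyFiniteMeasure hp₀
  obtain ⟨C, hC, h⟩ := exists_step_approximation (𝕜 := 𝕜) hp ha ha1 hw.1
  refine isPrecompact_of_step_approximation hp hw.1 hb ht fun ε hε A _ => ?_
  obtain ⟨r, hr, hr0⟩ := ((hc (ε / (C + 1)) (ENNReal.div_pos hε.ne' (by simp [hC]))).and
    self_mem_nhdsWithin).exists
  have hr0 : 0 < r := hr0
  refine ⟨r / 2, half_pos hr0, fun f hf => ?_⟩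
  obtain ⟨c, hcf⟩ := h r hr0 f (Lp.stronglyMeasurable f).measurable
  refine ⟨c, (setLIntegral_le_lintegral _ _).trans (hcf.trans ?_)⟩
  calc C * ∫⁻ x, translationMean a r f x ^ p ∂(wMeasure w) ≤ (C + 1) * (ε / (C + 1)) := by
        gcongr
        · exact le_self_add
        · exact hr f hf
    _ ≤ ε := ENNReal.mul_div_le

end Sufficiency

end BiParam

namespace BiParam

/-! ### Sufficiency of the condition on averages -/

section Averages

open scoped symmDiff

variable {𝕜 : Type*} [RCLike 𝕜] {n₁ n₂ : ℕ} {p r : ℝ} {w : Space n₁ n₂ → ℝ≥0∞}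

theorem volume_symmDiff_ball (x y : Space n₁ n₂) (r : ℝ) :
    volume (ball x r ∆ ball y r) =
      volume (((fun z => z - (y - x)) ⁻¹' ball 0 r) ∆ ball (0 : Space n₁ n₂) r) := by
  have h : (fun z => z - x) ⁻¹' (((fun z => z - (y - x)) ⁻¹' ball 0 r) ∆
      ball (0 : Space n₁ n₂) r) = ball y r ∆ ball x r := by
    rw [Set.preimage_symmDiff, ← preimage_comp]
    congr 1 <;> ext z <;> simp [ball]
  rw [symmDiff_comm, ← h]
  exact (measurePreserving_sub_right volume x).measure_preimage
    (((measurableSet_ball 0 r).preimage (measurable_id.sub_const _)).symmDiff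
      (measurableSet_ball 0 r)).nullMeasurableSet

/-- Translation is continuous in measure. Uniformity in `x` and `y` holds because the volume depends
only on `y - x`. -/
theorem exists_volume_symmDiff_ball_lt (n₁ n₂ : ℕ) (r : ℝ) {ε : ℝ≥0∞} (hε : 0 < ε) :
    ∃ δ : ℝ, 0 < δ ∧ ∀ x y : Space n₁ n₂, dist x y < δ → volume (ball x r ∆ ball y r) < ε := by
  have hcont : Tendsto (fun h : Space n₁ n₂ =>
      (⟨fun z => z - h, by fun_prop⟩ : C(Space n₁ n₂, Space n₁ n₂))) (𝓝 0)
      (𝓝 ⟨fun z => z - 0, by fun_prop⟩) := by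
    refine Continuous.tendsto (f := fun h : Space n₁ n₂ =>
      (⟨fun z => z - h, by fun_prop⟩ : C(Space n₁ n₂, Space n₁ n₂))) ?_ 0
    exact ContinuousMap.continuous_of_continuous_uncurry _ (by
      change Continuous fun q : Space n₁ n₂ × Space n₁ n₂ => q.2 - q.1
      fun_prop)
  have h := tendsto_measure_symmDiff_preimage_nhds_zero hcont
    (μ := volume) (ν := volume) (s := ball (0 : Space n₁ n₂) r)
    (Eventually.of_forall fun h => measurePreserving_sub_right volume h)
    (measurePreserving_sub_right volume 0) (measurableSet_ball 0 r).nullMeasurableSet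
    (volume_ball_lt_top 0 r).ne
  obtain ⟨δ, hδ, hlt⟩ := Metric.eventually_nhds_iff.1 (h.eventually (gt_mem_nhds hε))
  refine ⟨δ, hδ, fun x y hxy => ?_⟩
  rw [volume_symmDiff_ball]
  have := hlt (y := y - x) (by rwa [dist_zero_right, ← dist_eq_norm, dist_comm])
  simpa using this

theorem enorm_setIntegral_sub_setIntegral_le {f : Space n₁ n₂ → 𝕜} {s t : Set (Space n₁ n₂)}
    (hs : MeasurableSet s) (ht : MeasurableSet t) (hfs : IntegrableOn f s volume)
    (hft : IntegrableOn f t volume) :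
    ‖(∫ z in s, f z) - ∫ z in t, f z‖ₑ ≤ ∫⁻ z in s ∆ t, ‖f z‖ₑ := by
  rw [← integral_indicator hs, ← integral_indicator ht,
    ← integral_sub (hfs.integrable_indicator hs) (hft.integrable_indicator ht),
    ← lintegral_indicator (hs.symmDiff ht)]
  refine (enorm_integral_le_lintegral_enorm _).trans (lintegral_mono fun z => ?_)
  by_cases h1 : z ∈ s <;> by_cases h2 : z ∈ t <;> simp [h1, h2, mem_symmDiff]

/-- Averages of functions in a bounded set of `L^p(w)` are equicontinuous on bounded regions. -/
theorem IsAp.exists_enorm_average_sub_average_le (hp : 1 < p) (hw : IsAp p w) {M : ℝ≥0∞}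
    (hM : M ≠ ∞) (hr : 0 < r) (A : ℝ) {η : ℝ≥0∞} (hη : 0 < η) :
    ∃ δ : ℝ, 0 < δ ∧ ∀ x y : Space n₁ n₂, x ∈ Metric.ball 0 A → y ∈ Metric.ball 0 A →
      dist x y < δ → ∀ f : WLp 𝕜 p w, ∫⁻ z, ‖f z‖ₑ ^ p ∂(wMeasure w) ≤ M →
      ‖⨍ z in ball x r, f z ∂volume - ⨍ z in ball y r, f z ∂volume‖ₑ ≤ η := by
  have hp0 : 0 < p := by linarith
  have hp1 : 0 < p - 1 := by linarith
  set b := volume (ball (0 : Space n₁ n₂) r) with hb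
  have hb0 : b ≠ 0 := (volume_ball_pos 0 hr).ne'
  have hbt : b ≠ ∞ := (volume_ball_lt_top 0 r).ne
  set B : Set (Space n₁ n₂) := Metric.ball 0 (A + r) with hB
  have hBm : MeasurableSet B := Metric.isOpen_ball.measurableSet
  -- Chosen so that Hölder's bound `(M + 1) * θ ^ (p - 1)` is at most `(b * η) ^ p`.
  set θ := ((b * η) ^ p / (M + 1)) ^ (p - 1)⁻¹ with hθ
  have hbη : 0 < (b * η) ^ p :=
    ENNReal.rpow_pos_of_nonneg (ENNReal.mul_pos hb0 hη.ne') hp0.le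
  have hθ0 : 0 < θ := ENNReal.rpow_pos_of_nonneg
    (ENNReal.div_pos hbη.ne' (by simp [hM])) (by positivity)
  -- Absolute continuity of the integral of the dual weight over a ball that contains all averaging
  -- balls involved.
  obtain ⟨v, hv, hvθ⟩ := exists_pos_setLIntegral_lt_of_measure_lt (μ := volume)
    (f := B.indicator fun x => w x ^ (1 - p.conjExponent)) (by
      rw [lintegral_indicator hBm]
      exact (hw.lintegral_dual_metricBall_lt_top hp _ _).ne) hθ0.ne'
  obtain ⟨δ, hδ, hδv⟩ := exists_volume_symmDiff_ball_lt n₁ n₂ r hv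
  refine ⟨δ, hδ, fun x y hx hy hxy f hf => ?_⟩
  have hsub : ∀ x ∈ Metric.ball (0 : Space n₁ n₂) A, ball x r ⊆ B := fun x hx =>
    (ball_subset_metricBall x r).trans (Metric.ball_subset_ball' (by
      rw [Metric.mem_ball] at hx; linarith))
  set D := ball x r ∆ ball y r with hD
  have hDm : MeasurableSet D := (measurableSet_ball x r).symmDiff (measurableSet_ball y r)
  have hDB : D ⊆ B := symmDiff_subset_union.trans (union_subset (hsub x hx) (hsub y hy))
  have hσ : ∫⁻ z in D, w z ^ (1 - p.conjExponent) ≤ θ := by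
    refine le_trans (le_of_eq (setLIntegral_congr_fun hDm fun z hz => ?_))
      (hvθ D (hδv x y hxy)).le
    rw [indicator_of_mem (hDB hz)]
  have hDf : ∫⁻ z in D, ‖f z‖ₑ ≤ b * η := by
    rw [← ENNReal.rpow_le_rpow_iff hp0]
    calc (∫⁻ z in D, ‖f z‖ₑ) ^ p
        ≤ (∫⁻ z in D, ‖f z‖ₑ ^ p ∂(wMeasure w)) *
          (∫⁻ z in D, w z ^ (1 - p.conjExponent)) ^ (p - 1) :=
          hw.1.lintegral_rpow_le hp hDm (Lp.stronglyMeasurable f).enorm.aemeasurable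
      _ ≤ (M + 1) * θ ^ (p - 1) := by
          gcongr
          exact (setLIntegral_le_lintegral _ _).trans (hf.trans le_self_add)
      _ ≤ (b * η) ^ p := by
          rw [hθ, ENNReal.rpow_inv_rpow hp1.ne']
          exact ENNReal.mul_div_le
  simp only [setAverage_eq, Measure.real, volume_ball x r, volume_ball y r]
  rw [← smul_sub, enorm_smul, ← hb, ← ENNReal.toReal_inv,
    Real.enorm_eq_ofReal ENNReal.toReal_nonneg, ENNReal.ofReal_toReal (by simp [hb0])]
  calc b⁻¹ * ‖(∫ z in ball x r, f z) - ∫ z in ball y r, f z‖ₑ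
      ≤ b⁻¹ * (b * η) := by
        gcongr
        exact (enorm_setIntegral_sub_setIntegral_le (measurableSet_ball x r)
          (measurableSet_ball y r)
          (hw.integrableOn_of_isBounded hp f (measurableSet_ball x r) (isBounded_ball x r))
          (hw.integrableOn_of_isBounded hp f (measurableSet_ball y r) (isBounded_ball y r))).trans hDf
    _ = η := by rw [← mul_assoc, ENNReal.inv_mul_cancel hb0 hbt, one_mul]

/-- Hypothesis `hc` replaces `f` by its average at `x`, and equicontinuity moves this average to the
cell centre. The radius `r` is fixed first, and only then the mesh. -/
theorem isPrecompact_of_average (hp : 1 < p) (hw : IsAp p w) {K : Set (WLp 𝕜 p w)}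
    (hb : UniformlyBounded K) (ht : UniformlySmallTails K)
    (hc : ∀ ε : ℝ≥0∞, 0 < ε → ∀ᶠ r in 𝓝[>] (0 : ℝ), ∀ f ∈ K,
      ∫⁻ x, ‖f x - ⨍ y in ball x r, f y ∂volume‖ₑ ^ p ∂(wMeasure w) ≤ ε) :
    IsPrecompact K := by
  have := hw.isLocallyFiniteMeasure hp
  have hp0 : 0 < p := by linarith
  refine isPrecompact_of_step_approximation hp0 hw.1 hb ht fun ε hε A hA => ?_
  set e := ε / (2 * 2 ^ p) with he
  have he0 : 0 < e := ENNReal.div_pos hε.ne' (by finiteness)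
  obtain ⟨r, hr, hr0⟩ := ((hc e he0).and self_mem_nhdsWithin).exists
  have hr0 : 0 < r := hr0
  -- The mesh will be at most `1`, so cells meeting `ball 0 A` lie within `A + 1` of the origin and
  -- their centres within `A + 2`.
  set B : Set (Space n₁ n₂) := Metric.ball 0 (A + 2) with hB
  have hBt : wMeasure w B ≠ ∞ := measure_ball_lt_top.ne
  set η := (e / (wMeasure w B + 1)) ^ p⁻¹ with hη
  have hη0 : 0 < η := ENNReal.rpow_pos_of_nonneg
    (ENNReal.div_pos he0.ne' (by simp [hBt])) (by positivity)
  have hηB : η ^ p * wMeasure w B ≤ e := by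
    rw [hη, ENNReal.rpow_inv_rpow hp0.ne']
    calc e / (wMeasure w B + 1) * wMeasure w B
        ≤ e / (wMeasure w B + 1) * (wMeasure w B + 1) := by
          gcongr
          exact le_self_add
      _ ≤ e := by
          rw [mul_comm]
          exact ENNReal.mul_div_le
  obtain ⟨δ', hδ', hδη⟩ := hw.exists_enorm_average_sub_average_le (𝕜 := 𝕜) hp
    (M := (⨆ f ∈ K, wNorm p w (f : Space n₁ n₂ → 𝕜)) ^ p)
    (ENNReal.rpow_ne_top_of_nonneg hp0.le hb.ne) hr0 (A + 2) hη0
  set δ := min δ' 1 with hδ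
  have hδ0 : 0 < δ := lt_min hδ' one_pos
  have hδ1 : δ ≤ 1 := min_le_right _ _
  refine ⟨δ, hδ0, fun f hf => ?_⟩
  set U : Set (Space n₁ n₂) := gridIndex δ ⁻¹' (gridIndex δ '' ball 0 A)
  have hUm : MeasurableSet U := measurableSet_gridIndex_preimage δ _
  have hUA : U ⊆ Metric.ball 0 (A + δ) := preimage_gridIndex_image_ball_subset hδ0 A
  refine ⟨fun k => ⨍ y in ball (gridCenter δ k) r, f y ∂volume, ?_⟩
  have hfM : ∫⁻ x, ‖f x‖ₑ ^ p ∂(wMeasure w) ≤ (⨆ f ∈ K, wNorm p w (f : Space n₁ n₂ → 𝕜)) ^ p := by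
    rw [← wNorm_rpow hp0]
    exact ENNReal.rpow_le_rpow (le_iSup₂ (f := fun (f : WLp 𝕜 p w) (_ : f ∈ K) =>
      wNorm p w (f : Space n₁ n₂ → 𝕜)) f hf) hp0.le
  have hpt : ∀ x ∈ U, ‖f x - ⨍ y in ball (gridCenter δ (gridIndex δ x)) r, f y ∂volume‖ₑ ≤
      η + ‖f x - ⨍ y in ball x r, f y ∂volume‖ₑ := fun x hx => by
    have hd : dist x (gridCenter δ (gridIndex δ x)) < δ :=
      dist_lt_of_gridIndex_eq hδ0 (gridIndex_gridCenter hδ0 _).symm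
    have h1 := Metric.mem_ball.1 (hUA hx)
    refine le_trans (le_of_eq ?_) ((enorm_add_le _ _).trans (add_le_add_left
      (hδη x (gridCenter δ (gridIndex δ x)) ?_ ?_ (hd.trans_le (min_le_left _ _)) f hfM) _))
    · congr 1
      ring
    · rw [Metric.mem_ball]
      linarith
    · rw [Metric.mem_ball]
      linarith [dist_triangle (gridCenter δ (gridIndex δ x)) x 0,
        dist_comm x (gridCenter δ (gridIndex δ x))]
  calc ∫⁻ x in U, ‖f x - ⨍ y in ball (gridCenter δ (gridIndex δ x)) r, f y ∂volume‖ₑ ^ p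
        ∂(wMeasure w)
      ≤ ∫⁻ x in U, (η + ‖f x - ⨍ y in ball x r, f y ∂volume‖ₑ) ^ p ∂(wMeasure w) :=
        setLIntegral_mono' hUm fun x hx => ENNReal.rpow_le_rpow (hpt x hx) hp0.le
    _ ≤ 2 ^ p * (∫⁻ x in U, η ^ p ∂(wMeasure w) +
          ∫⁻ x in U, ‖f x - ⨍ y in ball x r, f y ∂volume‖ₑ ^ p ∂(wMeasure w)) :=
        lintegral_rpow_le_of_enorm_le_add hp0.le aemeasurable_const fun x => le_rfl
    _ ≤ 2 ^ p * (e + e) := by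
        gcongr
        · rw [setLIntegral_const]
          refine le_trans ?_ hηB
          gcongr
          exact hUA.trans (Metric.ball_subset_ball (by linarith))
        · exact (setLIntegral_le_lintegral _ _).trans (hr f hf)
    _ = (2 * 2 ^ p) * e := by ring
    _ ≤ ε := ENNReal.mul_div_le

end Averages

end BiParam

theorem mainTheorem6 (𝕜 : Type*) [RCLike 𝕜] (n₁ n₂ : ℕ) (hn₁ : 0 < n₁) (hn₂ : 0 < n₂) :
    (∀ (p₀ p a : ℝ) (w : BiParam.Space n₁ n₂ → ℝ≥0∞),
      1 < p₀ → BiParam.IsAp p₀ w → 0 < p → 0 < a → a < min (p / p₀) 1 →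
      ∀ K : Set (BiParam.WLp 𝕜 p w),
        BiParam.IsPrecompact K ↔
          BiParam.UniformlyBounded K ∧
          BiParam.UniformlySmallTails K ∧
          Tendsto (fun r : ℝ => ⨆ f ∈ K,
              BiParam.wNorm p w (BiParam.translationMean a r (f : BiParam.Space n₁ n₂ → 𝕜)))
            (𝓝[>] 0) (𝓝 0)) ∧
    (∀ (p : ℝ) (w : BiParam.Space n₁ n₂ → ℝ≥0∞),
      1 < p → BiParam.IsAp p w →
      ∀ K : Set (BiParam.WLp 𝕜 p w),
        BiParam.IsPrecompact K ↔
          BiParam.UniformlyBounded K ∧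
          BiParam.UniformlySmallTails K ∧
          Tendsto (fun r : ℝ => ⨆ f ∈ K,
              BiParam.wNorm p w (fun x : BiParam.Space n₁ n₂ =>
                f x - ⨍ y in BiParam.ball x r, f y ∂volume))
            (𝓝[>] 0) (𝓝 0)) := by
  refine ⟨fun p₀ p a w hp₀ hw hp ha hap K => ?_, fun p w hp hw K => ?_⟩
  · have ha1 : a ≤ 1 := (hap.trans_le (min_le_right _ _)).le
    have hap' : p₀ ≤ p / a := by
      have h := hap.trans_le (min_le_left _ _)
      rw [lt_div_iff₀ (by linarith)] at h
      rw [le_div_iff₀ ha]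
      linarith
    rw [BiParam.tendsto_iSup_wNorm_iff hp
      (fun (r : ℝ) (f : BiParam.WLp 𝕜 p w) => BiParam.translationMean a r f)]
    simp only [enorm_eq_self]
    exact ⟨fun hK => ⟨hK.uniformlyBounded hp, hK.uniformlySmallTails hp, fun ε hε =>
        hK.eventually_translationMean_le hp₀ hw hp ha ha1 hap' hε⟩,
      fun h => BiParam.isPrecompact_of_translationMean hp₀ hw hp ha ha1 h.1 h.2.1 h.2.2⟩
  · have hp0 : 0 < p := by linarith
    rw [BiParam.tendsto_iSup_wNorm_iff hp0
      (fun (r : ℝ) (f : BiParam.WLp 𝕜 p w) (x : BiParam.Space n₁ n₂) =>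
        f x - ⨍ y in BiParam.ball x r, f y ∂volume)]
    refine ⟨fun hK => ⟨hK.uniformlyBounded hp0, hK.uniformlySmallTails hp0, fun ε hε => ?_⟩,
      fun h => BiParam.isPrecompact_of_average hp hw h.1 h.2.1 h.2.2⟩
    -- The endpoint `a = 1`, `p₀ = p` is allowed here, as the bounds need only `p₀ ≤ p / a`.
    filter_upwards [hK.eventually_translationMean_le hp hw hp0 one_pos le_rfl (by simp) hε,
      self_mem_nhdsWithin] with r hr hr0 f hf
    refine (lintegral_mono fun x => ENNReal.rpow_le_rpow ?_ hp0.le).trans (hr f hf)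
    exact BiParam.enorm_sub_average_le_translationMean hr0
      (hw.integrableOn_of_isBounded hp f (BiParam.measurableSet_ball x r)
        (BiParam.isBounded_ball x r))
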